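/- **Language.** Let $\mathcal L_{FS}$ be the first-order language with equality, with constants $\mathsf k,\mathsf s,\mathsf p,\mathsf p_0,\mathsf p_1,\mathsf 0,\mathsf s_{\mathsf N},\mathsf p_{\mathsf N},\mathsf d_{\mathsf N},\dot=,\dot\neg,\dot\wedge,\dot\to,\dot\forall,\dot{\mathsf N},\dot{\mathsf T},\mathsf l$, binary application (written as juxtaposition), unary predicates $\mathrm N,\mathrm T,\mathrm U$, and primitive logical symbols $\neg,\wedge,\to,\forall$; $A\vee B$ stands for $\neg(\neg A\wedge\neg B)$ and $\exists x.A$ for $\neg\forall x.\neg A$. Write $(a,b)=\mathsf pab$, $(x)_i=\mathsf p_ix$, $\dot\neg x$, $x\,\dot=\,y=\dot=(x,y)$, and similarly for $\dot\wedge,\dot\to$. Let $\lambda x.t$ be bracket abstraction ($\lambda x.t=\mathsf kt$ if $x$ does not occur in $t$; $\lambda x.x=\mathsf{skk}$; $\lambda x.ts=\mathsf s(\lambda x.t)(\lambda x.s)$ otherwise). For a formula $A$ without $\mathrm U$, the term $\dot A$ is defined by: $s=t$, $\mathrm N(s)$, $\mathrm T(s)$ are sent to $s\,\dot=\,t$,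 $\dot{\mathsf N}s$, $\dot{\mathsf T}s$; $\neg A$, $A\wedge B$, $A\to B$ to $\dot\neg\dot A$, $\dot A\,\dot\wedge\,\dot B$, $\dot A\,\dot\to\,\dot B$; and $\forall x.A$ to $\dot\forall(\lambda x.\dot A)$. We also use a further binary predicate $\mathrm L_x(y)$ (not in $\mathcal L_{FS}$), with $\mathrm L_a(b)$ sent to $\mathsf lab$. **The theory $\mathsf{VFU}$** consists of the universal closures of the following axioms. (1) The total applicative theory $\mathsf{TON}$: - $\mathsf kab=a$; $\ \mathsf sabc=ac(bc)$; $\ (a,b)_0=a\wedge(a,b)_1=b$; - $\mathrm N(\mathsf 0)\wedge\forall x.\,\mathrm N(x)\to\mathrm N(\mathsf s_{\mathsf N}x)$; - $\forall x.\,\mathrm N(x)\to\mathsf s_{\mathsf N}x\ne\mathsf 0\wedge\mathsf p_{\mathsf N}(\mathsf s_{\mathsf N}x)=x$; - $\forall x.\,\mathrm N(x)\wedge x\ne\mathsf 0\to\mathrm N(\mathsf p_{\mathsf N}x)\wedge\mathsf s_{\mathsf N}(\mathsf p_{\mathsf N}x)=x$; - $\mathrm N(a)\wedge\mathrm N(b)\wedge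 a=b\to\mathsf d_{\mathsf N}uvab=u$; $\ \mathrm N(a)\wedge\mathrm N(b)\wedge a\ne b\to\mathsf d_{\mathsf N}uvab=v$; - $A(\mathsf 0)\wedge[\forall x.\,\mathrm N(x)\wedge A(x)\to A(\mathsf s_{\mathsf N}x)]\to\forall x.\,\mathrm N(x)\to A(x)$ for all $\mathcal L_{FS}$-formulas $A$. (2) With $\mathrm C(f):\equiv\forall x.\,\mathrm T(fx)\vee\mathrm T(\dot\neg(fx))$ and $f\sqsubset g:\equiv[\forall x.\,\mathrm T(fx)\to\mathrm T(g(fx))]\wedge[\forall x.\,\mathrm T(\dot\neg(fx))\to\mathrm T(g(\dot\neg(fx)))]$, for all $\mathcal L_{FS}$-formulas $A,B$ without $\mathrm U$: - (U-Out) $\mathrm U(u)\to[\mathrm T(u\dot A)\to A]$; - (U-Elem) $\mathrm U(u)\to[P\to\mathrm T(u\dot P)]$ for literals $P$ of the form $s=t$, $s\ne t$, $\mathrm N(s)$, $\neg\mathrm N(s)$; - (U-Imp) $\mathrm U(u)\to[\mathrm T(u(\dot A\,\dot\to\,\dot B))\to(\mathrm T(u\dot A)\to\mathrm T(u\dot B))]$;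 - (U-Univ) $\mathrm U(u)\to[(\forall x.\,\mathrm T(u\dot A))\to\mathrm T(u(\dot\forall(\lambda x.\dot A)))]$, where $x$ is a variable different from $u$; - (U-Log) $\mathrm U(u)\to\mathrm T(u\dot C)$ for every theorem $C$ (without $\mathrm U$) of classical first-order logic with equality; - (U-Cons) $\mathrm U(u)\to\forall x.\,\neg[\mathrm T(ux)\wedge\mathrm T(u(\dot\neg x))]$; - (U-Self) $\mathrm U(u)\to[\mathrm T(ux)\leftrightarrow\mathrm T(u(\dot{\mathsf T}x))]\wedge[\mathrm T(u(\dot\neg x))\leftrightarrow\mathrm T(u(\dot\neg(\dot{\mathsf T}x)))]$; - (U-Class) $\mathrm U(u)\to\mathrm C(u)$; - (U-True) $\mathrm U(u)\to\forall x.\,\mathrm T(ux)\to\mathrm T(x)$; - (Lim) $\mathrm C(f)\to\mathrm U(\mathsf lf)\wedge f\sqsubset\mathsf lf$. **The closed term model $\mathcal{CTT}$.** Its elements are the closed $\mathcal L_{FS}$-terms; application is juxtaposition; equality is convertibility with respect to the reductions $\mathsf kab\to a$, $\mathsf sabc\to ac(bc)$, $\mathsf p_0(a,b)\to a$, $\mathsf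 p_1(a,b)\to b$, $\mathsf p_{\mathsf N}(\mathsf s_{\mathsf N}\bar m)\to\bar m$, $\mathsf d_{\mathsf N}ab\bar m\bar m\to a$, $\mathsf d_{\mathsf N}ab\bar m\bar n\to b$ ($m\neq n$), where $\bar m=\mathsf s_{\mathsf N}(\cdots(\mathsf s_{\mathsf N}\mathsf 0))$; and $\mathrm N(x)$ means that $x$ is convertible to a numeral. Convertible terms are identified. **The calculus.** Consider sentences over $=,\mathrm N,\mathrm T,\mathrm L$ in negation normal form (built from literals by $\wedge,\vee,\forall,\exists$), represented by their codes $\dot A$; a sequent is a finite set of such codes, and we write $A$ for $\dot A$. Below, $\neg A$ denotes the negation normal form of the negation, and for a term $x=\dot A$ with $A$ any sentence over $=,\mathrm N,\mathrm T,\mathrm L$, "$\vdash x$" means derivability of $\{x'\}$, with $x'$ the (code of the) negation normal form of $A$; if $x$ is not of this form, then $\vdash x$ does not hold. By recursion on ordinals, $\vdash_{\alpha,\beta,\gamma}\Gamma$ ($\mathrm U$-rank $\alpha$, $\mathrm T$-rank $\beta$, length $\gamma$) is generated by the following rules, where $\vdash_{<\alpha}\Gamma$ means $\vdash_{\alpha_0,\beta_0,\gamma_0}\Gamma$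 for some $\alpha_0<\alpha$ and some $\beta_0,\gamma_0$, and $<\beta$, $<\gamma$ in an index stand for some smaller ordinal: - (Lit) $\vdash_{\alpha,\beta,\gamma}\Gamma,P$ for a literal $P$ in $=,\mathrm N$ true in $\mathcal{CTT}$; (Log) $\vdash_{\alpha,\beta,\gamma}\Gamma,\mathrm T(a),\neg\mathrm T(a)$; - ($\wedge$) from $\vdash_{\alpha,\beta,<\gamma}\Gamma,A_0\wedge A_1,A_i$ for both $i$, infer $\vdash_{\alpha,\beta,\gamma}\Gamma,A_0\wedge A_1$; ($\vee$) from $\vdash_{\alpha,\beta,<\gamma}\Gamma,A_0\vee A_1,A_i$ for one $i$, infer $\vdash_{\alpha,\beta,\gamma}\Gamma,A_0\vee A_1$; - ($\forall$) from $\vdash_{\alpha,\beta,<\gamma}\Gamma,\forall x.A(x),A(a)$ for all closed terms $a$, infer $\vdash_{\alpha,\beta,\gamma}\Gamma,\forall x.A(x)$; ($\exists$) from $\vdash_{\alpha,\beta,<\gamma}\Gamma,\exists x.A(x),A(a)$ for one $a$, infer $\vdash_{\alpha,\beta,\gamma}\Gamma,\exists x.A(x)$; - ($\mathrm T$) from $\vdash_{\alpha,<\beta,<\gamma}A$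 infer $\vdash_{\alpha,\beta,\gamma}\Gamma,\mathrm T(\dot A)$; ($\neg\mathrm T$) from $\vdash_{\alpha,<\beta,<\gamma}\neg A$ infer $\vdash_{\alpha,\beta,\gamma}\Gamma,\neg\mathrm T(\dot A)$; - (Weak) from $\vdash_{<\alpha}\Gamma$ infer $\vdash_{\alpha,\beta,\gamma}\Gamma$; - ($\mathrm U$) if $\dagger$ and $\vdash_{<\alpha}b$, infer $\vdash_{\alpha,\beta,\gamma}\Gamma,\mathrm L_a(b)$; ($\neg\mathrm U$) if $\dagger$ and not $\vdash_{<\alpha}b$, infer $\vdash_{\alpha,\beta,\gamma}\Gamma,\neg\mathrm L_a(b)$. Here $\dagger$ says: $\alpha$ is a successor ordinal; for every closed term $c$, $\vdash_{<\alpha}ac$ or $\vdash_{<\alpha}\dot\neg(ac)$; and neither $\vdash_{<\alpha}\mathrm L_a(b)$ nor $\vdash_{<\alpha}\neg\mathrm L_a(b)$. Write $\vdash\Gamma$ if $\vdash_{\alpha,\beta,\gamma}\Gamma$ for some $\alpha,\beta,\gamma$. **The model $\mathcal M_{\mathsf{VFU}}$** is the expansion of $\mathcal{CTT}$ in which every constant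 denotes itself, $\mathrm T(x)$ means $\vdash x$, and $\mathrm U(x)$ means that $x=\mathsf la$ for some closed term $a$ such that for every closed term $c$, $\vdash ac$ or $\vdash\dot\neg(ac)$. **Theorem.** $\mathcal M_{\mathsf{VFU}}\models\mathsf{VFU}$. -/

import Mathlib

namespace FregeVFU

/-! ## Terms -/

/-- The individual constants of the language of Frege structures (with the extra constant for the
truth predicate).  Constants ending in `D` are the "dotted" sentence constructors. -/
inductive Const : Type
  | k | s | p | p0 | p1 | zero | sN | pN | dN
  | eqD | negD | andD | impD | allD | natD | trD | l

/-- Applicative terms with free variables among `x_0, …, x_{n-1}` (de Bruijn indices: under a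
binder, `0` is the bound variable and the older variables are shifted by one). -/
inductive Tm : ℕ → Type
  | var {n : ℕ} (i : Fin n) : Tm n
  | const {n : ℕ} (c : Const) : Tm n
  | app {n : ℕ} (f a : Tm n) : Tm n

namespace Tm

infixl:70 " ⬝ " => Tm.app

/-- Substitution of terms for the free variables. -/
def subst {n m : ℕ} (σ : Fin n → Tm m) : Tm n → Tm m
  | var i => σ i
  | const c => const c
  | app f a => subst σ f ⬝ subst σ a

/-- The same term in a context with one more (newest) variable. -/
def weaken {n : ℕ} (t : Tm n) : Tm (n + 1) := t.subst fun i => var i.succ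

/-- `t` without the newest variable, if that variable does not occur in `t`. -/
def strengthen {n : ℕ} : Tm (n + 1) → Option (Tm n)
  | var i => Fin.cases none (fun j => some (var j)) i
  | const c => some (const c)
  | app f a =>
    match strengthen f, strengthen a with
    | some f₁, some a₁ => some (f₁ ⬝ a₁)
    | _, _ => none

/-- Bracket abstraction `λ x. t` of the newest variable: `λ x. t = k t` if `x` does not occur in
`t`, `λ x. x = s k k`, and `λ x. f a = s (λ x. f) (λ x. a)` otherwise.  This abstraction commutes
with substitutions for the other variables. -/
def lam {n : ℕ} : Tm (n + 1) → Tm n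
  | var i => Fin.cases (const .s ⬝ const .k ⬝ const .k) (fun j => const .k ⬝ var j) i
  | const c => const .k ⬝ const c
  | app f a =>
    match strengthen (f ⬝ a) with
    | some t => const .k ⬝ t
    | none => const .s ⬝ lam f ⬝ lam a

/-- The pair `(a, b) = p a b`. -/
def pair {n : ℕ} (a b : Tm n) : Tm n := const .p ⬝ a ⬝ b

/-- The numeral `s_N (… (s_N 0))`. -/
def numeral : ℕ → Tm 0
  | 0 => const .zero
  | m + 1 => const .sN ⬝ numeral m

/-- The dotted equation `s ≐ t`. -/
def eqD {n : ℕ} (s t : Tm n) : Tm n := const .eqD ⬝ pair s t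

/-- The dotted negation. -/
def negD {n : ℕ} (s : Tm n) : Tm n := const .negD ⬝ s

/-- The dotted conjunction. -/
def andD {n : ℕ} (s t : Tm n) : Tm n := const .andD ⬝ pair s t

/-- The dotted conditional. -/
def impD {n : ℕ} (s t : Tm n) : Tm n := const .impD ⬝ pair s t

end Tm

/-! ## Formulas

`Fml u l n` is the type of formulas in `n` free variables over the predicates `=`, `N`, `T`,
together with the unary predicate `U` if `u` holds and the binary predicate `L` if `l` holds.
The primitive logical symbols are `¬`, `∧`, `→`, `∀`.

* `Fml True False` are the formulas of the language of Frege structures;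
* `Fml False False` are the formulas `A` of that language for which the term `Ȧ` is defined;
* `Fml False True` are the formulas coded by terms once `l a b` is read as the code of `L_a(b)`. -/
inductive Fml (u l : Prop) : ℕ → Type
  | eq {n : ℕ} (s t : Tm n) : Fml u l n
  | nat {n : ℕ} (s : Tm n) : Fml u l n
  | tr {n : ℕ} (s : Tm n) : Fml u l n
  | univ {n : ℕ} (h : u) (s : Tm n) : Fml u l n
  | lev {n : ℕ} (h : l) (a b : Tm n) : Fml u l n
  | neg {n : ℕ} (A : Fml u l n) : Fml u l n
  | and {n : ℕ} (A B : Fml u l n) : Fml u l n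
  | imp {n : ℕ} (A B : Fml u l n) : Fml u l n
  | all {n : ℕ} (A : Fml u l (n + 1)) : Fml u l n

namespace Fml

/-- `A ∨ B`, a defined symbol. -/
def or {u l : Prop} {n : ℕ} (A B : Fml u l n) : Fml u l n := neg (and (neg A) (neg B))

/-- `A ↔ B`, a defined symbol. -/
def iff {u l : Prop} {n : ℕ} (A B : Fml u l n) : Fml u l n := and (imp A B) (imp B A)

/-- Capture-avoiding substitution of terms for the free variables. -/
def subst {u l : Prop} {n m : ℕ} (σ : Fin n → Tm m) : Fml u l n → Fml u l m
  | eq s t => eq (s.subst σ) (t.subst σ)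
  | nat s => nat (s.subst σ)
  | tr s => tr (s.subst σ)
  | univ h s => univ h (s.subst σ)
  | lev h a b => lev h (a.subst σ) (b.subst σ)
  | neg A => neg (A.subst σ)
  | and A B => and (A.subst σ) (B.subst σ)
  | imp A B => imp (A.subst σ) (B.subst σ)
  | all A => all (A.subst (Fin.cons (Tm.var 0) fun i => (σ i).weaken))

/-- The same formula in a context with one more (newest) variable. -/
def weaken {u l : Prop} {n : ℕ} (A : Fml u l n) : Fml u l (n + 1) :=
  A.subst fun i => Tm.var i.succ

/-- `A(t)`: the term `t` for the newest variable of `A`. -/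
def inst {u l : Prop} {n : ℕ} (A : Fml u l (n + 1)) (t : Tm n) : Fml u l n :=
  A.subst (Fin.cons t Tm.var)

/-- The universal closure. -/
def close {u l : Prop} : {n : ℕ} → Fml u l n → Fml u l 0
  | 0, A => A
  | _ + 1, A => close (all A)

/-- A formula without `U` and `L`, read as a formula of the language of Frege structures. -/
def toFS {n : ℕ} : Fml False False n → Fml True False n
  | eq s t => eq s t
  | nat s => nat s
  | tr s => tr s
  | univ h _ => h.elim
  | lev h _ _ => h.elim
  | neg A => neg A.toFS
  | and A B => and A.toFS B.toFS
  | imp A B => imp A.toFS B.toFS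
  | all A => all A.toFS

/-- The term `Ȧ` corresponding to the formula `A`. -/
def dot {l : Prop} {n : ℕ} : Fml False l n → Tm n
  | eq s t => Tm.eqD s t
  | nat s => Tm.const .natD ⬝ s
  | tr s => Tm.const .trD ⬝ s
  | univ h _ => h.elim
  | lev _ a b => Tm.const .l ⬝ a ⬝ b
  | neg A => Tm.negD A.dot
  | and A B => Tm.andD A.dot B.dot
  | imp A B => Tm.impD A.dot B.dot
  | all A => Tm.const .allD ⬝ A.dot.lam

end Fml

/-- Theorems of classical first-order logic with equality, by a standard Hilbert calculus. -/
inductive LogThm {u l : Prop} : {n : ℕ} → Fml u l n → Prop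
  | ax_k {n : ℕ} (A B : Fml u l n) : LogThm (.imp A (.imp B A))
  | ax_s {n : ℕ} (A B C : Fml u l n) :
      LogThm (.imp (.imp A (.imp B C)) (.imp (.imp A B) (.imp A C)))
  | ax_contra {n : ℕ} (A B : Fml u l n) :
      LogThm (.imp (.imp (.neg A) (.neg B)) (.imp B A))
  | ax_and_left {n : ℕ} (A B : Fml u l n) : LogThm (.imp (.and A B) A)
  | ax_and_right {n : ℕ} (A B : Fml u l n) : LogThm (.imp (.and A B) B)
  | ax_and_intro {n : ℕ} (A B : Fml u l n) : LogThm (.imp A (.imp B (.and A B)))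
  | ax_inst {n : ℕ} (A : Fml u l (n + 1)) (t : Tm n) : LogThm (.imp (.all A) (A.inst t))
  | ax_all {n : ℕ} (A : Fml u l n) (B : Fml u l (n + 1)) :
      LogThm (.imp (.all (.imp A.weaken B)) (.imp A (.all B)))
  | ax_refl {n : ℕ} (t : Tm n) : LogThm (.eq t t)
  | ax_leibniz {n : ℕ} (A : Fml u l (n + 1)) (s t : Tm n) :
      LogThm (.imp (.eq s t) (.imp (A.inst s) (A.inst t)))
  | mp {n : ℕ} {A B : Fml u l n} : LogThm (.imp A B) → LogThm A → LogThm B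
  | gen {n : ℕ} {A : Fml u l (n + 1)} : LogThm A → LogThm (.all A)

/-! ## Structures for the language of Frege structures -/

/-- A structure for the language of Frege structures (with `=` interpreted as identity). -/
structure FSStructure where
  carrier : Type
  const : Const → carrier
  app : carrier → carrier → carrier
  N : carrier → Prop
  T : carrier → Prop
  U : carrier → Prop

namespace FSStructure

/-- The value of a term under an assignment. -/
def eval (M : FSStructure) {n : ℕ} (ρ : Fin n → M.carrier) : Tm n → M.carrier
  | .var i => ρ i
  | .const c => M.const c
  | .app f a => M.app (M.eval ρ f) (M.eval ρ a)

/-- Tarskian satisfaction of a formula under an assignment. -/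
def Sat (M : FSStructure) : {n : ℕ} → (Fin n → M.carrier) → Fml True False n → Prop
  | _, ρ, .eq s t => M.eval ρ s = M.eval ρ t
  | _, ρ, .nat s => M.N (M.eval ρ s)
  | _, ρ, .tr s => M.T (M.eval ρ s)
  | _, ρ, .univ _ s => M.U (M.eval ρ s)
  | _, _, .lev h _ _ => h.elim
  | _, ρ, .neg A => ¬ M.Sat ρ A
  | _, ρ, .and A B => M.Sat ρ A ∧ M.Sat ρ B
  | _, ρ, .imp A B => M.Sat ρ A → M.Sat ρ B
  | _, ρ, .all A => ∀ d : M.carrier, M.Sat (Fin.cons d ρ) A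

/-- `M` is a model of a set of sentences. -/
def Models (M : FSStructure) (Th : Set (Fml True False 0)) : Prop :=
  ∀ A ∈ Th, M.Sat Fin.elim0 A

end FSStructure

/-! ## The theory `VFU` -/

section Axioms

/-- Formulas of the language of Frege structures. -/
abbrev FS (n : ℕ) : Type := Fml True False n

/-- The variable with index `i` (in a context of size `n + 1`, `n + 2`, …). -/
abbrev v {n : ℕ} (i : Fin n) : Tm n := Tm.var i

/-- The axioms of the total applicative theory (to be closed universally), with induction for all
formulas of the language of Frege structures. -/
inductive TONAx : {n : ℕ} → FS n → Prop
  -- `k a b = a`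
  | k : TONAx (n := 2) (.eq (.const .k ⬝ v 0 ⬝ v 1) (v 0))
  -- `s a b c = a c (b c)`
  | s : TONAx (n := 3) (.eq (.const .s ⬝ v 0 ⬝ v 1 ⬝ v 2) (v 0 ⬝ v 2 ⬝ (v 1 ⬝ v 2)))
  -- `(a, b)_0 = a ∧ (a, b)_1 = b`
  | pair : TONAx (n := 2)
      (.and (.eq (.const .p0 ⬝ .pair (v 0) (v 1)) (v 0))
        (.eq (.const .p1 ⬝ .pair (v 0) (v 1)) (v 1)))
  -- `N 0 ∧ ∀ x. N x → N (s_N x)`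
  | nat : TONAx (n := 0)
      (.and (.nat (.const .zero)) (.all (.imp (.nat (v 0)) (.nat (.const .sN ⬝ v 0)))))
  -- `∀ x. N x → s_N x ≠ 0 ∧ p_N (s_N x) = x`
  | succ : TONAx (n := 0)
      (.all (.imp (.nat (v 0))
        (.and (.neg (.eq (.const .sN ⬝ v 0) (.const .zero)))
          (.eq (.const .pN ⬝ (.const .sN ⬝ v 0)) (v 0)))))
  -- `∀ x. N x ∧ x ≠ 0 → N (p_N x) ∧ s_N (p_N x) = x`
  | pred : TONAx (n := 0)
      (.all (.imp (.and (.nat (v 0)) (.neg (.eq (v 0) (.const .zero))))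
        (.and (.nat (.const .pN ⬝ v 0)) (.eq (.const .sN ⬝ (.const .pN ⬝ v 0)) (v 0)))))
  -- `N a ∧ N b ∧ a = b → d_N u v a b = u`, with `u, v, a, b` the variables `0, 1, 2, 3`
  | cases_eq : TONAx (n := 4)
      (.imp (.and (.nat (v 2)) (.and (.nat (v 3)) (.eq (v 2) (v 3))))
        (.eq (.const .dN ⬝ v 0 ⬝ v 1 ⬝ v 2 ⬝ v 3) (v 0)))
  -- `N a ∧ N b ∧ a ≠ b → d_N u v a b = v`
  | cases_ne : TONAx (n := 4)
      (.imp (.and (.nat (v 2)) (.and (.nat (v 3)) (.neg (.eq (v 2) (v 3)))))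
        (.eq (.const .dN ⬝ v 0 ⬝ v 1 ⬝ v 2 ⬝ v 3) (v 1)))
  -- `A(0) ∧ [∀ x. N x ∧ A(x) → A(s_N x)] → ∀ x. N x → A(x)`
  | ind {n : ℕ} (A : FS (n + 1)) : TONAx
      (.imp
        (.and (A.inst (.const .zero))
          (.all (.imp (.and (.nat (v 0)) A)
            (A.subst (Fin.cons (.const .sN ⬝ v 0) fun i => v i.succ)))))
        (.all (.imp (.nat (v 0)) A)))

/-- `L`-literals: `s = t`, `s ≠ t`, `N s`, `¬ N s`. -/
inductive IsLit : {n : ℕ} → Fml False False n → Prop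
  | eq {n : ℕ} (s t : Tm n) : IsLit (.eq s t)
  | ne {n : ℕ} (s t : Tm n) : IsLit (.neg (.eq s t))
  | nat {n : ℕ} (s : Tm n) : IsLit (.nat s)
  | nnat {n : ℕ} (s : Tm n) : IsLit (.neg (.nat s))

/-- The formula `C(f)`, i.e. `∀ x. T(f x) ∨ T(¬̇ (f x))`. -/
def isClass {n : ℕ} (f : Tm n) : FS n :=
  .all (.or (.tr (f.weaken ⬝ v 0)) (.tr (.negD (f.weaken ⬝ v 0))))

/-- The formula `f ⊏ g`, i.e. `[∀ x. T(f x) → T(g (f x))] ∧ [∀ x. T(¬̇ (f x)) → T(g (¬̇ (f x)))]`. -/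
def reflects {n : ℕ} (f g : Tm n) : FS n :=
  .and
    (.all (.imp (.tr (f.weaken ⬝ v 0)) (.tr (g.weaken ⬝ (f.weaken ⬝ v 0)))))
    (.all (.imp (.tr (.negD (f.weaken ⬝ v 0))) (.tr (g.weaken ⬝ .negD (f.weaken ⬝ v 0)))))

/-- The axioms of `VFU` (to be closed universally).  In the schemata `u` is any of the variables,
possibly one occurring in `A`. -/
inductive VFUAx : {n : ℕ} → FS n → Prop
  | ton {n : ℕ} {A : FS n} : TONAx A → VFUAx A
  -- `U(u) → [T(u Ȧ) → A]`
  | u_out {n : ℕ} (u : Fin n) (A : Fml False False n) : VFUAx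
      (.imp (.univ trivial (v u)) (.imp (.tr (v u ⬝ A.dot)) A.toFS))
  -- `U(u) → [P → T(u Ṗ)]`
  | u_elem {n : ℕ} (u : Fin n) (P : Fml False False n) (hP : IsLit P) : VFUAx
      (.imp (.univ trivial (v u)) (.imp P.toFS (.tr (v u ⬝ P.dot))))
  -- `U(u) → [T(u (A → B)˙) → (T(u Ȧ) → T(u Ḃ))]`
  | u_imp {n : ℕ} (u : Fin n) (A B : Fml False False n) : VFUAx
      (.imp (.univ trivial (v u))
        (.imp (.tr (v u ⬝ (Fml.imp A B).dot)) (.imp (.tr (v u ⬝ A.dot)) (.tr (v u ⬝ B.dot)))))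
  -- `U(u) → [(∀ x. T(u Ȧ)) → T(u (∀ x. A)˙)]`
  | u_univ {n : ℕ} (u : Fin n) (A : Fml False False (n + 1)) : VFUAx
      (.imp (.univ trivial (v u))
        (.imp (.all (.tr (v u.succ ⬝ A.dot))) (.tr (v u ⬝ (Fml.all A).dot))))
  -- `U(u) → T(u Ċ)` for every logical theorem `C`
  | u_log {n : ℕ} (u : Fin n) (C : Fml False False n) (hC : LogThm C) : VFUAx
      (.imp (.univ trivial (v u)) (.tr (v u ⬝ C.dot)))
  -- `U(u) → ∀ x. ¬ [T(u x) ∧ T(u (¬̇ x))]`, where under the quantifier `u` has index `1`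
  | u_cons : VFUAx (n := 1)
      (.imp (.univ trivial (v 0))
        (.all (.neg (.and (.tr (v 1 ⬝ v 0)) (.tr (v 1 ⬝ .negD (v 0)))))))
  -- `U(u) → [T(u x) ↔ T(u (Ṫ x))] ∧ [T(u (¬̇ x)) ↔ T(u (¬̇ (Ṫ x)))]`, with `u, x` the variables `0, 1`
  | u_self : VFUAx (n := 2)
      (.imp (.univ trivial (v 0))
        (.and
          (.iff (.tr (v 0 ⬝ v 1)) (.tr (v 0 ⬝ (.const .trD ⬝ v 1))))
          (.iff (.tr (v 0 ⬝ .negD (v 1))) (.tr (v 0 ⬝ .negD (.const .trD ⬝ v 1))))))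
  -- `U(u) → C(u)`
  | u_class : VFUAx (n := 1) (.imp (.univ trivial (v 0)) (isClass (v 0)))
  -- `U(u) → ∀ x. T(u x) → T(x)`
  | u_true : VFUAx (n := 1)
      (.imp (.univ trivial (v 0)) (.all (.imp (.tr (v 1 ⬝ v 0)) (.tr (v 0)))))
  -- `C(f) → U(l f) ∧ f ⊏ l f`
  | lim : VFUAx (n := 1)
      (.imp (isClass (v 0))
        (.and (.univ trivial (.const .l ⬝ v 0)) (reflects (v 0) (.const .l ⬝ v 0))))

/-- The theory `VFU`: the universal closures of its axioms. -/
def VFU : Set (Fml True False 0) := {A | ∃ (n : ℕ) (B : FS n), VFUAx B ∧ A = B.close}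

end Axioms

/-! ## The closed total term model -/

/-- One-step reduction of closed terms. -/
inductive Red : Tm 0 → Tm 0 → Prop
  | k (a b : Tm 0) : Red (.const .k ⬝ a ⬝ b) a
  | s (a b c : Tm 0) : Red (.const .s ⬝ a ⬝ b ⬝ c) (a ⬝ c ⬝ (b ⬝ c))
  | p0 (a b : Tm 0) : Red (.const .p0 ⬝ .pair a b) a
  | p1 (a b : Tm 0) : Red (.const .p1 ⬝ .pair a b) b
  | pN (m : ℕ) : Red (.const .pN ⬝ (.const .sN ⬝ .numeral m)) (.numeral m)
  | dN_eq (a b : Tm 0) (m : ℕ) : Red (.const .dN ⬝ a ⬝ b ⬝ .numeral m ⬝ .numeral m) a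
  | dN_ne (a b : Tm 0) (m m₁ : ℕ) (h : m ≠ m₁) :
      Red (.const .dN ⬝ a ⬝ b ⬝ .numeral m ⬝ .numeral m₁) b
  | app_left {f g : Tm 0} (a : Tm 0) : Red f g → Red (f ⬝ a) (g ⬝ a)
  | app_right (f : Tm 0) {a b : Tm 0} : Red a b → Red (f ⬝ a) (f ⬝ b)

/-- Closed terms up to convertibility, i.e. modulo the equivalence relation generated by `Red`.
Terms with a common reduct are thus not distinguished. -/
def CTT : Type := Quot Red

namespace CTT

noncomputable instance : DecidableEq CTT := Classical.decEq _

/-- Application is juxtaposition. -/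
def app : CTT → CTT → CTT :=
  Quot.map₂ Tm.app (fun f _ _ h => Red.app_right f h) (fun _ _ a h => Red.app_left a h)

/-- Every constant denotes itself. -/
def const (c : Const) : CTT := Quot.mk Red (.const c)

/-- The value of an open term when closed terms are substituted for its variables. -/
def val {n : ℕ} (ρ : Fin n → CTT) : Tm n → CTT
  | .var i => ρ i
  | .const c => const c
  | .app f a => app (val ρ f) (val ρ a)

/-- `x` is (convertible to) a numeral. -/
def IsNum (x : CTT) : Prop := ∃ m : ℕ, x = Quot.mk Red (.numeral m)

/-- `b ≐ c` -/
def eqD (b c : CTT) : CTT := app (const .eqD) (app (app (const .p) b) c)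
/-- `¬̇ b` -/
def negD (b : CTT) : CTT := app (const .negD) b
/-- `Ṅ b` -/
def natD (b : CTT) : CTT := app (const .natD) b
/-- `Ṫ b` -/
def trD (b : CTT) : CTT := app (const .trD) b
/-- `l a b`, the code of `L_a(b)` -/
def lev (a b : CTT) : CTT := app (app (const .l) a) b

end CTT

/-! ## The infinitary sequent calculus -/

/-- Formulas in negation normal form over the predicates `=`, `N`, `T`, `L`. -/
inductive NNF : ℕ → Type
  | eq {n : ℕ} (s t : Tm n) : NNF n
  | ne {n : ℕ} (s t : Tm n) : NNF n
  | nat {n : ℕ} (s : Tm n) : NNF n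
  | nnat {n : ℕ} (s : Tm n) : NNF n
  | tr {n : ℕ} (s : Tm n) : NNF n
  | ntr {n : ℕ} (s : Tm n) : NNF n
  | lev {n : ℕ} (a b : Tm n) : NNF n
  | nlev {n : ℕ} (a b : Tm n) : NNF n
  | and {n : ℕ} (A B : NNF n) : NNF n
  | or {n : ℕ} (A B : NNF n) : NNF n
  | all {n : ℕ} (A : NNF (n + 1)) : NNF n
  | ex {n : ℕ} (A : NNF (n + 1)) : NNF n

/-- A formula in negation normal form as a formula in `¬`, `∧`, `→`, `∀`, where `A ∨ B` stands for
`¬(¬A ∧ ¬B)` and `∃ x. A` for `¬ ∀ x. ¬A`. -/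
def NNF.toFml {n : ℕ} : NNF n → Fml False True n
  | eq s t => .eq s t
  | ne s t => .neg (.eq s t)
  | nat s => .nat s
  | nnat s => .neg (.nat s)
  | tr s => .tr s
  | ntr s => .neg (.tr s)
  | lev a b => .lev trivial a b
  | nlev a b => .neg (.lev trivial a b)
  | and A B => .and A.toFml B.toFml
  | or A B => .or A.toFml B.toFml
  | all A => .all A.toFml
  | ex A => .neg (.all (.neg A.toFml))

/-- `A.nnf true` is the negation normal form of `A`, and `A.nnf false` that of `¬ A`. -/
def Fml.nnf {l : Prop} {n : ℕ} : Bool → Fml False l n → NNF n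
  | true, .eq s t => .eq s t
  | false, .eq s t => .ne s t
  | true, .nat s => .nat s
  | false, .nat s => .nnat s
  | true, .tr s => .tr s
  | false, .tr s => .ntr s
  | _, .univ h _ => h.elim
  | true, .lev _ a b => .lev a b
  | false, .lev _ a b => .nlev a b
  | b, .neg A => A.nnf (!b)
  | true, .and A B => .and (A.nnf true) (B.nnf true)
  | false, .and A B => .or (A.nnf false) (B.nnf false)
  | true, .imp A B => .or (A.nnf false) (B.nnf true)
  | false, .imp A B => .and (A.nnf true) (B.nnf false)
  | true, .all A => .all (A.nnf true)
  | false, .all A => .ex (A.nnf false)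

/-- The code `Ȧ` of the sentence obtained from the formula `A` by substituting the closed terms `ρ`
for its free variables.  As the abstraction `Tm.lam` commutes with such substitutions, every
sentence is captured by a formula together with closed terms for its variables. -/
def Fml.code {n : ℕ} (A : Fml False True n) (ρ : Fin n → CTT) : CTT := CTT.val ρ A.dot

/-- The code of a sentence in negation normal form. -/
def NNF.code {n : ℕ} (A : NNF n) (ρ : Fin n → CTT) : CTT := A.toFml.code ρ

/-- Sequents are finite sets of (codes of) sentences; convertible terms are identified. -/
abbrev Sequent : Type := Finset CTT

/-- With `P` for derivability of sequents, `Proves P x` says that the sequent `{x'}` is derivable,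
where `x'` is the negation normal form of the sentence coded by `x` (in particular, that `x` codes
a sentence). -/
def Proves (P : Sequent → Prop) (x : CTT) : Prop :=
  ∃ (n : ℕ) (A : Fml False True n) (ρ : Fin n → CTT), x = A.code ρ ∧ P {(A.nnf true).code ρ}

/-- `a : Class`: for every closed term `c`, one of `a c` and `¬̇ (a c)` is derivable. -/
def IsClassIn (P : Sequent → Prop) (a : CTT) : Prop :=
  ∀ c : CTT, Proves P (CTT.app a c) ∨ Proves P (CTT.negD (CTT.app a c))

/-- The side condition of the rules `(U)` and `(¬U)` at stage `α`, with `P` for derivability at a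
stage below `α`: `α` is a successor, `a` is a class and `L_a(b)` is not a proposition below `α`. -/
def SideCond (α : Ordinal.{0}) (P : Sequent → Prop) (a b : CTT) : Prop :=
  (∃ α₀ : Ordinal.{0}, α = Order.succ α₀) ∧ IsClassIn P a ∧
    ¬ P {CTT.lev a b} ∧ ¬ P {CTT.negD (CTT.lev a b)}

/-- The rules of the calculus at `U`-rank `α`, with `P` for derivability at some rank below `α`;
the two ordinal indices are the `T`-rank `β` and the length `γ`.  A principal formula of a rule is a
member of the sequent `Γ`. -/
inductive Step (α : Ordinal.{0}) (P : Sequent → Prop) :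
    Ordinal.{0} → Ordinal.{0} → Sequent → Prop
  | lit_eq {β γ : Ordinal.{0}} {Γ : Sequent} (b c : CTT) :
      CTT.eqD b c ∈ Γ → b = c → Step α P β γ Γ
  | lit_ne {β γ : Ordinal.{0}} {Γ : Sequent} (b c : CTT) :
      CTT.negD (CTT.eqD b c) ∈ Γ → b ≠ c → Step α P β γ Γ
  | lit_nat {β γ : Ordinal.{0}} {Γ : Sequent} (b : CTT) :
      CTT.natD b ∈ Γ → b.IsNum → Step α P β γ Γ
  | lit_nnat {β γ : Ordinal.{0}} {Γ : Sequent} (b : CTT) :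
      CTT.negD (CTT.natD b) ∈ Γ → ¬ b.IsNum → Step α P β γ Γ
  | log {β γ : Ordinal.{0}} {Γ : Sequent} (b : CTT) :
      CTT.trD b ∈ Γ → CTT.negD (CTT.trD b) ∈ Γ → Step α P β γ Γ
  | and {β γ γ₀ γ₁ : Ordinal.{0}} {Γ : Sequent} {n : ℕ} (A B : NNF n) (ρ : Fin n → CTT) :
      (NNF.and A B).code ρ ∈ Γ → γ₀ < γ → γ₁ < γ →
      Step α P β γ₀ (insert (A.code ρ) Γ) → Step α P β γ₁ (insert (B.code ρ) Γ) →
      Step α P β γ Γ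
  | or_left {β γ γ₀ : Ordinal.{0}} {Γ : Sequent} {n : ℕ} (A B : NNF n) (ρ : Fin n → CTT) :
      (NNF.or A B).code ρ ∈ Γ → γ₀ < γ →
      Step α P β γ₀ (insert (A.code ρ) Γ) → Step α P β γ Γ
  | or_right {β γ γ₀ : Ordinal.{0}} {Γ : Sequent} {n : ℕ} (A B : NNF n) (ρ : Fin n → CTT) :
      (NNF.or A B).code ρ ∈ Γ → γ₀ < γ →
      Step α P β γ₀ (insert (B.code ρ) Γ) → Step α P β γ Γ
  | ex {β γ γ₀ : Ordinal.{0}} {Γ : Sequent} {n : ℕ} (A : NNF (n + 1)) (ρ : Fin n → CTT) (a : CTT) :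
      (NNF.ex A).code ρ ∈ Γ → γ₀ < γ →
      Step α P β γ₀ (insert (A.code (Fin.cons a ρ)) Γ) → Step α P β γ Γ
  | all {β γ : Ordinal.{0}} {Γ : Sequent} {n : ℕ} (A : NNF (n + 1)) (ρ : Fin n → CTT)
      (γ₀ : CTT → Ordinal.{0}) :
      (NNF.all A).code ρ ∈ Γ → (∀ a, γ₀ a < γ) →
      (∀ a, Step α P β (γ₀ a) (insert (A.code (Fin.cons a ρ)) Γ)) → Step α P β γ Γ
  | tr {β γ β₀ γ₀ : Ordinal.{0}} {Γ : Sequent} {n : ℕ} (A : Fml False True n) (ρ : Fin n → CTT) :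
      CTT.trD (A.code ρ) ∈ Γ → β₀ < β → γ₀ < γ →
      Step α P β₀ γ₀ {(A.nnf true).code ρ} → Step α P β γ Γ
  | ntr {β γ β₀ γ₀ : Ordinal.{0}} {Γ : Sequent} {n : ℕ} (A : Fml False True n) (ρ : Fin n → CTT) :
      CTT.negD (CTT.trD (A.code ρ)) ∈ Γ → β₀ < β → γ₀ < γ →
      Step α P β₀ γ₀ {(A.nnf false).code ρ} → Step α P β γ Γ
  | weak {β γ : Ordinal.{0}} {Γ : Sequent} : P Γ → Step α P β γ Γ
  | univ {β γ : Ordinal.{0}} {Γ : Sequent} (a b : CTT) :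
      CTT.lev a b ∈ Γ → SideCond α P a b → Proves P b → Step α P β γ Γ
  | nuniv {β γ : Ordinal.{0}} {Γ : Sequent} (a b : CTT) :
      CTT.negD (CTT.lev a b) ∈ Γ → SideCond α P a b → ¬ Proves P b → Step α P β γ Γ

/-- `Der α β γ Γ`: the sequent `Γ` is derivable with `U`-rank `α`, `T`-rank `β` and length `γ`. -/
def Der (α : Ordinal.{0}) : Ordinal.{0} → Ordinal.{0} → Sequent → Prop :=
  Step α fun Γ => ∃ (α₀ : Ordinal.{0}) (_ : α₀ < α) (β γ : Ordinal.{0}), Der α₀ β γ Γ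
termination_by α

/-- Derivability of a sequent with some ranks and some length. -/
def Derivable (Γ : Sequent) : Prop := ∃ α β γ : Ordinal.{0}, Der α β γ Γ

/-! ## The model -/

/-- The truth-as-provability model: the closed total term model in which `T(x)` means that (the
negation normal form of) `x` is derivable, and `U(x)` means that `x = l a` for some `a` that is
derivably a class. -/
def modelVFU : FSStructure where
  carrier := CTT
  const := CTT.const
  app := CTT.app
  N := CTT.IsNum
  T := Proves Derivable
  U := fun x => ∃ a : CTT, x = CTT.app (CTT.const .l) a ∧ IsClassIn Derivable a

end FregeVFU

/-! The universe `l a` above a class `a` is provability at one fixed `U`-rank. Let `α` be the least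
rank at which every `a c` is decided. A successor rank up to `α` has a predecessor below `α`, where
`a` is not yet a class, so neither `L_a(b)` nor its negation is derivable at a rank up to `α`. At `α
+ 1` the side condition therefore holds for all `b`, and `L_a(b)` or `¬L_a(b)` becomes an axiom
according to whether `b` is provable at rank `α`. By consistency, `l a b` is derivable exactly if
`b` is provable at `α` (`exists_rank_of_isClassIn`). Each axiom about `U` thus becomes a statement
about provability at a fixed rank.

These statements rest on two theorems. Cut is admissible (`Deriv.cut`), by induction on the
lexicographically ordered pair of `U`-rank and `T`-rank and then on the size of the cut formula. A
cut on `T(A)` with both sides introduced by the truth rules becomes a cut between `{A}` and `{¬A}`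
at a smaller rank; this would derive the empty sequent, which no rule does. Cut yields consistency
and modus ponens. Soundness (`Deriv.sound`) says that every derivable sequent contains a true
sentence when `T` and `L` are read as derivability, which gives (U-Out). For the rest, the
infinitary `∀` rule gives (U-Univ), excluded middle for `L`-free formulas gives (U-Log), and
(U-Self) holds because the truth rules raise the `T`-rank but keep the `U`-rank.

Sequents consist of codes modulo conversion, so codes must determine sentences well enough.
Confluence makes the sentence constructors injective with disjoint ranges, so a code reveals its
outermost symbol and the codes of its instances. Without extensionality, however, formulas with the
same code may have negation normal forms whose codes differ inside abstractions. The relation `Sim`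
absorbs this difference, and `Deriv.sim` shows that derivability does not see it. -/

namespace FregeVFU

/-! ## Confluence of the reduction of closed terms -/

/-- Contraction of a redex at the root. -/
inductive Root : Tm 0 → Tm 0 → Prop
  | k (a b : Tm 0) : Root (.const .k ⬝ a ⬝ b) a
  | s (a b c : Tm 0) : Root (.const .s ⬝ a ⬝ b ⬝ c) (a ⬝ c ⬝ (b ⬝ c))
  | p0 (a b : Tm 0) : Root (.const .p0 ⬝ (.const .p ⬝ a ⬝ b)) a
  | p1 (a b : Tm 0) : Root (.const .p1 ⬝ (.const .p ⬝ a ⬝ b)) b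
  | pN (m : ℕ) : Root (.const .pN ⬝ (.const .sN ⬝ .numeral m)) (.numeral m)
  | dN_eq (a b : Tm 0) (m : ℕ) : Root (.const .dN ⬝ a ⬝ b ⬝ .numeral m ⬝ .numeral m) a
  | dN_ne (a b : Tm 0) (m m₁ : ℕ) (h : m ≠ m₁) :
      Root (.const .dN ⬝ a ⬝ b ⬝ .numeral m ⬝ .numeral m₁) b

/-- Parallel reduction: reduce both parts of an application, then possibly contract the root. -/
inductive Par : Tm 0 → Tm 0 → Prop
  | const (c : Const) : Par (.const c) (.const c)
  | app {f f' a a' : Tm 0} : Par f f' → Par a a' → Par (f ⬝ a) (f' ⬝ a')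
  | root {f f' a a' t : Tm 0} : Par f f' → Par a a' → Root (f' ⬝ a') t → Par (f ⬝ a) t

theorem Tm.numeral_injective : Function.Injective Tm.numeral := by
  intro m
  induction m with
  | zero => intro n h; cases n with
    | zero => rfl
    | succ n => simp [Tm.numeral] at h
  | succ m ih => intro n h; cases n with
    | zero => simp [Tm.numeral] at h
    | succ n => simp only [Tm.numeral, Tm.app.injEq, true_and] at h; rw [ih h]

theorem Root.red {t u : Tm 0} (h : Root t u) : Red t u := by
  cases h
  · exact Red.k _ _
  · exact Red.s _ _ _
  · exact Red.p0 _ _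
  · exact Red.p1 _ _
  · exact Red.pN _
  · exact Red.dN_eq _ _ _
  · exact Red.dN_ne _ _ _ _ ‹_›

/-- Different rules clash at the head constant, except the two for `d_N`, which injectivity of
numerals separates. Keeping `e` as a hypothesis spares the case analysis from unifying indices that
contain `numeral m`. -/
theorem Root.unique {t t' u v : Tm 0} (h : Root t u) (h' : Root t' v) (e : t = t') : u = v := by
  cases h <;> cases h' <;> simp only [Tm.app.injEq, Tm.const.injEq, reduceCtorEq, false_and,
    and_false, true_and, Tm.numeral_injective.eq_iff] at e <;> grind

theorem Par.refl (t : Tm 0) : Par t t := by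
  induction t with
  | var i => exact i.elim0
  | const c => exact .const c
  | app f a hf ha => exact .app hf ha

theorem Par.of_red {t u : Tm 0} (h : Red t u) : Par t u := by
  induction h with
  | k a b => exact .root (.refl _) (.refl _) (.k _ _)
  | s a b c => exact .root (.refl _) (.refl _) (.s _ _ _)
  | p0 a b => exact .root (.refl _) (.refl _) (.p0 _ _)
  | p1 a b => exact .root (.refl _) (.refl _) (.p1 _ _)
  | pN m => exact .root (.refl _) (.refl _) (.pN _)
  | dN_eq a b m => exact .root (.refl _) (.refl _) (.dN_eq _ _ _)
  | dN_ne a b m m₁ h => exact .root (.refl _) (.refl _) (.dN_ne _ _ _ _ h)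
  | app_left a _ ih => exact .app ih (.refl _)
  | app_right f _ ih => exact .app (.refl _) ih

theorem Par.const_inv {c : Const} {t : Tm 0} (h : Par (.const c) t) : t = .const c := by
  cases h; rfl

/-- The excluded constants are those heading a redex with a single argument; `k`, `s` and `d_N`
still lack arguments here. -/
theorem Par.app_const_inv {c : Const} {a t : Tm 0} (hc : c ≠ .p0 ∧ c ≠ .p1 ∧ c ≠ .pN)
    (h : Par (.const c ⬝ a) t) : ∃ a', t = .const c ⬝ a' ∧ Par a a' := by
  cases h with
  | app hf ha => obtain rfl := hf.const_inv; exact ⟨_, rfl, ha⟩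
  | root hf ha hr =>
    obtain rfl := hf.const_inv
    cases hr <;> simp at hc

theorem Par.app_app_const_inv {c : Const} {a b t : Tm 0}
    (hc : c ≠ .k ∧ c ≠ .p0 ∧ c ≠ .p1 ∧ c ≠ .pN) (h : Par (.const c ⬝ a ⬝ b) t) :
    ∃ a' b', t = .const c ⬝ a' ⬝ b' ∧ Par a a' ∧ Par b b' := by
  cases h with
  | app hf hb => obtain ⟨a', rfl, ha⟩ := hf.app_const_inv hc.2; exact ⟨_, _, rfl, ha, hb⟩
  | root hf hb hr =>
    obtain ⟨a', rfl, ha⟩ := hf.app_const_inv hc.2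
    cases hr; simp at hc

theorem Par.dN_inv {a b d t : Tm 0} (h : Par (.const .dN ⬝ a ⬝ b ⬝ d) t) :
    ∃ a' b' d', t = .const .dN ⬝ a' ⬝ b' ⬝ d' ∧ Par a a' ∧ Par b b' ∧ Par d d' := by
  cases h with
  | app hf hd =>
    obtain ⟨a', b', rfl, ha, hb⟩ := hf.app_app_const_inv (by simp)
    exact ⟨_, _, _, rfl, ha, hb, hd⟩
  | root hf hd hr =>
    obtain ⟨a', b', rfl, ha, hb⟩ := hf.app_app_const_inv (by simp)
    cases hr

/-- Neither `0` nor `s_N` heads a redex, so numerals are normal. Hence the rules for `p_N` and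
`d_N`, which demand numerals, remain applicable after their arguments are reduced. -/
theorem Par.numeral_inv {m : ℕ} {t : Tm 0} (h : Par (.numeral m) t) : t = .numeral m := by
  induction m generalizing t with
  | zero => exact h.const_inv
  | succ m ih =>
    obtain ⟨a, rfl, ha⟩ := Par.app_const_inv (by simp) h
    rw [ih ha]; rfl

/-- Redexes persist under parallel reduction of their parts. -/
theorem Root.par {f a f' a' t : Tm 0} (h : Root (f ⬝ a) t) (hf : Par f f') (ha : Par a a') :
    ∃ t', Root (f' ⬝ a') t' ∧ Par t t' := by
  cases h with
  | k b _ =>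
    obtain ⟨b', rfl, hb⟩ := hf.app_const_inv (by simp)
    exact ⟨_, .k _ _, hb⟩
  | s b c _ =>
    obtain ⟨b', c', rfl, hb, hc⟩ := hf.app_app_const_inv (by simp)
    exact ⟨_, .s _ _ _, .app (.app hb ha) (.app hc ha)⟩
  | p0 b c =>
    obtain rfl := hf.const_inv
    obtain ⟨b', c', rfl, hb, hc⟩ := ha.app_app_const_inv (by simp)
    exact ⟨_, .p0 _ _, hb⟩
  | p1 b c =>
    obtain rfl := hf.const_inv
    obtain ⟨b', c', rfl, hb, hc⟩ := ha.app_app_const_inv (by simp)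
    exact ⟨_, .p1 _ _, hc⟩
  | pN m =>
    obtain rfl := hf.const_inv
    obtain rfl := Par.numeral_inv (m := m + 1) ha
    exact ⟨_, .pN _, .refl _⟩
  | dN_eq b c m =>
    obtain ⟨b', c', d', rfl, hb, hc, hd⟩ := hf.dN_inv
    obtain rfl := hd.numeral_inv
    obtain rfl := ha.numeral_inv
    exact ⟨_, .dN_eq _ _ _, hb⟩
  | dN_ne b c m m₁ h =>
    obtain ⟨b', c', d', rfl, hb, hc, hd⟩ := hf.dN_inv
    obtain rfl := hd.numeral_inv
    obtain rfl := ha.numeral_inv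
    exact ⟨_, .dN_ne _ _ _ _ h, hc⟩

/-- A parallel step first reduces the two parts of an application. The induction hypotheses join
these parts, and a contraction made on either side survives the joining by `Root.par`. -/
theorem Par.diamond {t u v : Tm 0} (hu : Par t u) (hv : Par t v) : ∃ w, Par u w ∧ Par v w := by
  induction t generalizing u v with
  | var i => exact i.elim0
  | const c =>
    obtain rfl := hu.const_inv
    obtain rfl := hv.const_inv
    exact ⟨_, .const c, .const c⟩
  | app f a ihf iha =>
    cases hu with
    | app hf ha =>
      cases hv with
      | app hf' ha' =>
        obtain ⟨g, h₁, h₂⟩ := ihf hf hf'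
        obtain ⟨b, h₃, h₄⟩ := iha ha ha'
        exact ⟨_, .app h₁ h₃, .app h₂ h₄⟩
      | root hf' ha' hr =>
        obtain ⟨g, h₁, h₂⟩ := ihf hf hf'
        obtain ⟨b, h₃, h₄⟩ := iha ha ha'
        obtain ⟨t', hr', ht⟩ := hr.par h₂ h₄
        exact ⟨t', .root h₁ h₃ hr', ht⟩
    | root hf ha hr =>
      cases hv with
      | app hf' ha' =>
        obtain ⟨g, h₁, h₂⟩ := ihf hf hf'
        obtain ⟨b, h₃, h₄⟩ := iha ha ha'
        obtain ⟨t', hr', ht⟩ := hr.par h₁ h₃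
        exact ⟨t', ht, .root h₂ h₄ hr'⟩
      | root hf' ha' hs =>
        obtain ⟨g, h₁, h₂⟩ := ihf hf hf'
        obtain ⟨b, h₃, h₄⟩ := iha ha ha'
        obtain ⟨t', hr', ht⟩ := hr.par h₁ h₃
        obtain ⟨t'', hs', ht'⟩ := hs.par h₂ h₄
        -- Once the parts are joined, both sides contract the same redex.
        obtain rfl := hr'.unique hs' rfl
        exact ⟨t', ht, ht'⟩

open Relation in
/-- The Church-Rosser theorem for the closed term model. -/
theorem CTT.exists_common_reduct {t u : Tm 0} (h : (Quot.mk Red t : CTT) = Quot.mk Red u) :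
    ∃ w, ReflTransGen Par t w ∧ ReflTransGen Par u w := by
  have hE := equivalence_join_reflTransGen (r := Par) fun a b c hab hac => by
    obtain ⟨d, hb, hc⟩ := Par.diamond hab hac
    exact ⟨d, .single hb, .single hc⟩
  have h' := Quot.eqvGen_exact h
  clear h
  induction h' with
  | rel x y h => exact ⟨y, .single (.of_red h), .refl⟩
  | refl x => exact hE.refl x
  | symm x y _ ih => exact hE.symm ih
  | trans x y z _ _ ih₁ ih₂ => exact hE.trans ih₁ ih₂

theorem CTT.sound_par {t u : Tm 0} (h : Par t u) : (Quot.mk Red t : CTT) = Quot.mk Red u := by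
  induction h with
  | const c => rfl
  | app _ _ ihf iha => exact congrArg₂ CTT.app ihf iha
  | root _ _ hr ihf iha => exact (congrArg₂ CTT.app ihf iha).trans (Quot.sound hr.red)

open Relation in
theorem CTT.sound_pars {t u : Tm 0} (h : ReflTransGen Par t u) :
    (Quot.mk Red t : CTT) = Quot.mk Red u := by
  induction h with
  | refl => rfl
  | tail _ h ih => exact ih.trans (CTT.sound_par h)

/-- The constants that never head a redex. -/
def Const.inert : Const → Prop
  | .k | .s | .p0 | .p1 | .pN | .dN => False
  | _ => True

section Inert
open Relation

variable {c d : Const} {t : Tm 0}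

theorem pars_const (h : ReflTransGen Par (.const c) t) : t = .const c := by
  induction h with
  | refl => rfl
  | tail _ h ih => subst ih; exact h.const_inv

theorem pars_app_const {a : Tm 0} (hc : c.inert) (h : ReflTransGen Par (.const c ⬝ a) t) :
    ∃ a', t = .const c ⬝ a' ∧ ReflTransGen Par a a' := by
  induction h with
  | refl => exact ⟨a, rfl, .refl⟩
  | tail _ h ih =>
    obtain ⟨a', rfl, ha⟩ := ih
    obtain ⟨a'', rfl, ha'⟩ :=
      h.app_const_inv (by refine ⟨?_, ?_, ?_⟩ <;> rintro rfl <;> exact hc)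
    exact ⟨a'', rfl, ha.tail ha'⟩

theorem pars_app_app_const {a b : Tm 0} (hc : c.inert)
    (h : ReflTransGen Par (.const c ⬝ a ⬝ b) t) :
    ∃ a' b', t = .const c ⬝ a' ⬝ b' ∧ ReflTransGen Par a a' ∧ ReflTransGen Par b b' := by
  induction h with
  | refl => exact ⟨a, b, rfl, .refl, .refl⟩
  | tail _ h ih =>
    obtain ⟨a', b', rfl, ha, hb⟩ := ih
    obtain ⟨a'', b'', rfl, ha', hb'⟩ :=
      h.app_app_const_inv (by refine ⟨?_, ?_, ?_, ?_⟩ <;> rintro rfl <;> exact hc)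
    exact ⟨a'', b'', rfl, ha.tail ha', hb.tail hb'⟩

namespace CTT

theorem const_ne_app_const (hd : d.inert) (x : CTT) : CTT.const c ≠ app (CTT.const d) x := by
  obtain ⟨x, rfl⟩ := Quot.exists_rep x
  intro h
  obtain ⟨w, h₁, h₂⟩ := exists_common_reduct h
  rw [pars_const h₁] at h₂
  obtain ⟨_, h, _⟩ := pars_app_const hd h₂
  cases h

/-- An application headed by an inert constant reduces only inside its argument, so a common reduct
exhibits both the constant and a common reduct of the arguments. -/
theorem app_const_inj (hc : c.inert) (hd : d.inert) {x y : CTT} :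
    app (CTT.const c) x = app (CTT.const d) y ↔ c = d ∧ x = y := by
  obtain ⟨x, rfl⟩ := Quot.exists_rep x
  obtain ⟨y, rfl⟩ := Quot.exists_rep y
  refine ⟨fun h => ?_, fun h => by rw [h.1, h.2]⟩
  obtain ⟨w, h₁, h₂⟩ := exists_common_reduct h
  obtain ⟨x', rfl, hx⟩ := pars_app_const hc h₁
  obtain ⟨y', h, hy⟩ := pars_app_const hd h₂
  cases h
  exact ⟨rfl, (sound_pars hx).trans (sound_pars hy).symm⟩

theorem app_app_const_inj (hc : c.inert) (hd : d.inert) {x y x' y' : CTT} :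
    app (app (CTT.const c) x) x' = app (app (CTT.const d) y) y' ↔ c = d ∧ x = y ∧ x' = y' := by
  obtain ⟨x, rfl⟩ := Quot.exists_rep x
  obtain ⟨y, rfl⟩ := Quot.exists_rep y
  obtain ⟨x', rfl⟩ := Quot.exists_rep x'
  obtain ⟨y', rfl⟩ := Quot.exists_rep y'
  refine ⟨fun h => ?_, fun h => by rw [h.1, h.2.1, h.2.2]⟩
  obtain ⟨w, h₁, h₂⟩ := exists_common_reduct h
  obtain ⟨_, _, rfl, hx, hx'⟩ := pars_app_app_const hc h₁
  obtain ⟨_, _, h, hy, hy'⟩ := pars_app_app_const hd h₂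
  cases h
  exact ⟨rfl, (sound_pars hx).trans (sound_pars hy).symm,
    (sound_pars hx').trans (sound_pars hy').symm⟩

theorem app_const_ne_app_app_const (hc : c.inert) (hd : d.inert) (x y y' : CTT) :
    app (CTT.const c) x ≠ app (app (CTT.const d) y) y' := by
  obtain ⟨x, rfl⟩ := Quot.exists_rep x
  obtain ⟨y, rfl⟩ := Quot.exists_rep y
  obtain ⟨y', rfl⟩ := Quot.exists_rep y'
  intro h
  obtain ⟨w, h₁, h₂⟩ := exists_common_reduct h
  obtain ⟨_, rfl, _⟩ := pars_app_const hc h₁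
  obtain ⟨_, _, h, _⟩ := pars_app_app_const hd h₂
  cases h

/-! ## Values of terms -/

theorem app_k (a b : CTT) : app (app (CTT.const .k) a) b = a := by
  obtain ⟨a, rfl⟩ := Quot.exists_rep a
  obtain ⟨b, rfl⟩ := Quot.exists_rep b
  exact Quot.sound (.k a b)

theorem app_s (a b c : CTT) :
    app (app (app (CTT.const .s) a) b) c = app (app a c) (app b c) := by
  obtain ⟨a, rfl⟩ := Quot.exists_rep a
  obtain ⟨b, rfl⟩ := Quot.exists_rep b
  obtain ⟨c, rfl⟩ := Quot.exists_rep c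
  exact Quot.sound (.s a b c)

theorem val_strengthen {n : ℕ} (t : Tm (n + 1)) {t' : Tm n} (h : t.strengthen = some t')
    (ρ : Fin n → CTT) (c : CTT) : val (Fin.cons c ρ) t = val ρ t' := by
  induction t generalizing t' with
  | var i =>
    induction i using Fin.cases with
    | zero => simp [Tm.strengthen] at h
    | succ j =>
      simp only [Tm.strengthen, Fin.cases_succ, Option.some.injEq] at h
      subst h; rfl
  | const c => simp only [Tm.strengthen, Option.some.injEq] at h; subst h; rfl
  | app f a ihf iha =>
    simp only [Tm.strengthen] at h
    split at h
    · rename_i f₁ a₁ hf ha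
      cases h
      simp only [val, ihf hf, iha ha]
    · cases h

/-- This `β`-law is what recovers the instances of a quantified sentence from its code. Nothing
recovers the abstraction from its instances. -/
theorem val_lam {n : ℕ} (t : Tm (n + 1)) (ρ : Fin n → CTT) (c : CTT) :
    app (val ρ t.lam) c = val (Fin.cons c ρ) t := by
  induction t with
  | var i =>
    induction i using Fin.cases with
    | zero => simp [Tm.lam, val, app_s, app_k]
    | succ j => simp [Tm.lam, val, app_k]
  | const c => simp [Tm.lam, val, app_k]
  | app f a ihf iha =>
    simp only [Tm.lam]
    split
    · rename_i t' h
      rw [val_strengthen _ h]; simp [val, app_k]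
    · simp [val, app_s, ihf, iha]

theorem val_subst {n m : ℕ} (σ : Fin n → Tm m) (ρ : Fin m → CTT) (t : Tm n) :
    val ρ (t.subst σ) = val (fun i => val ρ (σ i)) t := by
  induction t with
  | var i => rfl
  | const c => rfl
  | app f a ihf iha => simp only [Tm.subst, val, ihf, iha]

end CTT
end Inert

/-! ## Codes of sentences -/

namespace CTT

/-- `b ∧̇ c` -/
def andD (b c : CTT) : CTT := app (const .andD) (app (app (const .p) b) c)
/-- `b →̇ c` -/
def impD (b c : CTT) : CTT := app (const .impD) (app (app (const .p) b) c)
/-- `∀̇ f` -/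
def allD (f : CTT) : CTT := app (const .allD) f

section
variable {a b c d : CTT}

theorem eqD_inj : eqD a b = eqD c d ↔ a = c ∧ b = d :=
  (app_const_inj (by trivial) (by trivial)).trans <| by
    rw [app_app_const_inj (by trivial) (by trivial)]; simp
theorem andD_inj : andD a b = andD c d ↔ a = c ∧ b = d :=
  (app_const_inj (by trivial) (by trivial)).trans <| by
    rw [app_app_const_inj (by trivial) (by trivial)]; simp
theorem impD_inj : impD a b = impD c d ↔ a = c ∧ b = d :=
  (app_const_inj (by trivial) (by trivial)).trans <| by
    rw [app_app_const_inj (by trivial) (by trivial)]; simp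
theorem lev_inj : lev a b = lev c d ↔ a = c ∧ b = d :=
  (app_app_const_inj (by trivial) (by trivial)).trans <| by simp
theorem negD_inj : negD a = negD b ↔ a = b :=
  (app_const_inj (by trivial) (by trivial)).trans <| by simp
theorem natD_inj : natD a = natD b ↔ a = b :=
  (app_const_inj (by trivial) (by trivial)).trans <| by simp
theorem trD_inj : trD a = trD b ↔ a = b :=
  (app_const_inj (by trivial) (by trivial)).trans <| by simp
theorem allD_inj : allD a = allD b ↔ a = b :=
  (app_const_inj (by trivial) (by trivial)).trans <| by simp

/-- The sentence constructors have disjoint ranges. -/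
inductive Head : Const → CTT → Prop
  | eqD (b c : CTT) : Head .eqD (eqD b c)
  | andD (b c : CTT) : Head .andD (andD b c)
  | impD (b c : CTT) : Head .impD (impD b c)
  | lev (b c : CTT) : Head .l (lev b c)
  | negD (b : CTT) : Head .negD (negD b)
  | natD (b : CTT) : Head .natD (natD b)
  | trD (b : CTT) : Head .trD (trD b)
  | allD (b : CTT) : Head .allD (allD b)

theorem Head.unique {i j : Const} {x y : CTT} (h : Head i x) (h' : Head j y) (e : x = y) :
    i = j := by
  cases h <;> cases h' <;> first
    | rfl
    | exact ((app_const_inj (by trivial) (by trivial)).1 e).1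
    | exact (app_const_ne_app_app_const (by trivial) (by trivial) _ _ _ e).elim
    | exact (app_const_ne_app_app_const (by trivial) (by trivial) _ _ _ e.symm).elim

/-- The outermost sentence constructor below an optional negation. -/
inductive SignedHead : Bool × Const → CTT → Prop
  | pos {i : Const} {x : CTT} : i ≠ .negD → Head i x → SignedHead (true, i) x
  | neg {i : Const} {x : CTT} : Head i x → SignedHead (false, i) (CTT.negD x)

theorem SignedHead.unique {i j : Bool × Const} {x y : CTT} (h : SignedHead i x)
    (h' : SignedHead j y) (e : x = y) : i = j := by
  cases h with
  | pos hi h =>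
    cases h' with
    | pos _ h' => rw [h.unique h' e]
    | neg h' => exact (hi (h.unique (.negD _) e)).elim
  | neg h =>
    cases h' with
    | pos hj h' => exact (hj (h'.unique (.negD _) e.symm)).elim
    | neg h' => rw [h.unique h' (negD_inj.1 e)]

end
end CTT

open CTT

namespace NNF

variable {n : ℕ} (ρ : Fin n → CTT)

theorem code_eq (s t : Tm n) : (NNF.eq s t).code ρ = eqD (val ρ s) (val ρ t) := rfl
theorem code_ne (s t : Tm n) : (NNF.ne s t).code ρ = negD (eqD (val ρ s) (val ρ t)) := rfl
theorem code_nat (s : Tm n) : (NNF.nat s).code ρ = natD (val ρ s) := rfl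
theorem code_nnat (s : Tm n) : (NNF.nnat s).code ρ = negD (natD (val ρ s)) := rfl
theorem code_tr (s : Tm n) : (NNF.tr s).code ρ = trD (val ρ s) := rfl
theorem code_ntr (s : Tm n) : (NNF.ntr s).code ρ = negD (trD (val ρ s)) := rfl

/-- The outermost constructor of the code of a formula below an optional negation. -/
def head {n : ℕ} : NNF n → Bool × Const
  | eq _ _ => (true, .eqD)
  | ne _ _ => (false, .eqD)
  | nat _ => (true, .natD)
  | nnat _ => (false, .natD)
  | tr _ => (true, .trD)
  | ntr _ => (false, .trD)
  | lev _ _ => (true, .l)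
  | nlev _ _ => (false, .l)
  | and _ _ => (true, .andD)
  | or _ _ => (false, .andD)
  | all _ => (true, .allD)
  | ex _ => (false, .allD)

/-- Since `∨` and `∃` are coded as `¬(¬ ∧ ¬)` and `¬∀¬`, one optional negation and the constructor
below it already distinguish all twelve kinds of formula. -/
theorem signedHead_code (F : NNF n) : SignedHead F.head (F.code ρ) := by
  cases F with
  | eq s t => exact .pos (by simp) (.eqD _ _)
  | ne s t => exact .neg (.eqD _ _)
  | nat s => exact .pos (by simp) (.natD _)
  | nnat s => exact .neg (.natD _)
  | tr s => exact .pos (by simp) (.trD _)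
  | ntr s => exact .neg (.trD _)
  | lev s t => exact .pos (by simp) (.lev _ _)
  | nlev s t => exact .neg (.lev _ _)
  | and A B => exact .pos (by simp) (.andD _ _)
  | or A B => exact .neg (.andD _ _)
  | all A => exact .pos (by simp) (.allD _)
  | ex A => exact .neg (.allD _)

/-- The dual formula, the negation normal form of the negation. -/
def dual {n : ℕ} : NNF n → NNF n
  | eq s t => ne s t
  | ne s t => eq s t
  | nat s => nnat s
  | nnat s => nat s
  | tr s => ntr s
  | ntr s => tr s
  | lev a b => nlev a b
  | nlev a b => lev a b
  | and A B => or A.dual B.dual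
  | or A B => and A.dual B.dual
  | all A => ex A.dual
  | ex A => all A.dual

/-- The number of logical symbols. -/
def size {n : ℕ} : NNF n → ℕ
  | and A B => A.size + B.size + 1
  | or A B => A.size + B.size + 1
  | all A => A.size + 1
  | ex A => A.size + 1
  | _ => 0

end NNF

theorem Fml.dual_nnf {l : Prop} {n : ℕ} (A : Fml False l n) (b : Bool) :
    (A.nnf b).dual = A.nnf (!b) := by
  induction A generalizing b with
  | univ h => exact h.elim
  | neg A ih => cases b <;> exact ih _
  | _ => cases b <;> simp_all [Fml.nnf, NNF.dual]

/-- A sentence in negation normal form, given as a formula with closed terms for its variables. -/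
structure Sent where
  {n : ℕ}
  formula : NNF n
  env : Fin n → CTT

/-- The kind of the outermost symbol of a sentence. -/
inductive Kind
  | lit | tr | ntr | conj | disj

namespace Sent

/-- The code of a sentence. -/
def code (S : Sent) : CTT := S.formula.code S.env

/-- The dual sentence. -/
def dual (S : Sent) : Sent := ⟨S.formula.dual, S.env⟩

/-- The kind of a sentence. -/
def kind : Sent → Kind
  | ⟨.tr _, _⟩ => .tr
  | ⟨.ntr _, _⟩ => .ntr
  | ⟨.and _ _, _⟩ => .conj
  | ⟨.all _, _⟩ => .conj
  | ⟨.or _ _, _⟩ => .disj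
  | ⟨.ex _, _⟩ => .disj
  | _ => .lit

/-- The immediate subsentences: the Boolean chooses between two immediate subformulas, the term is
the instance of a quantified formula. -/
def sub : Sent → Bool → CTT → Sent
  | ⟨.and A B, ρ⟩, i, _ => ⟨cond i A B, ρ⟩
  | ⟨.or A B, ρ⟩, i, _ => ⟨cond i A B, ρ⟩
  | ⟨.all A, ρ⟩, _, c => ⟨A, Fin.cons c ρ⟩
  | ⟨.ex A, ρ⟩, _, c => ⟨A, Fin.cons c ρ⟩
  | S, _, _ => S

/-- The kind of the dual sentence. -/
def _root_.FregeVFU.Kind.dual : Kind → Kind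
  | .lit => .lit
  | .tr => .ntr
  | .ntr => .tr
  | .conj => .disj
  | .disj => .conj

theorem kind_dual (S : Sent) : S.dual.kind = S.kind.dual := by
  obtain ⟨F, ρ⟩ := S
  cases F <;> rfl

theorem sub_dual (S : Sent) (i : Bool) (c : CTT) (h : S.kind = .conj ∨ S.kind = .disj) :
    S.dual.sub i c = (S.sub i c).dual := by
  obtain ⟨F, ρ⟩ := S
  cases F <;> first | rfl | (cases i <;> rfl)

theorem size_sub (S : Sent) (i : Bool) (c : CTT) (h : S.kind = .conj ∨ S.kind = .disj) :
    (S.sub i c).formula.size < S.formula.size := by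
  obtain ⟨F, ρ⟩ := S
  cases F <;> first
    | (cases i <;> simp only [sub, NNF.size, cond_true, cond_false] <;> omega)
    | simp [kind] at h

theorem app_lam_negD {n : ℕ} (t : Tm (n + 1)) (ρ : Fin n → CTT) (c : CTT) :
    app (val ρ (Tm.negD t).lam) c = negD (val (Fin.cons c ρ) t) := val_lam _ _ _

/-- Sentences with the same code have the same kind, and immediate subsentences with the same
codes. -/
theorem code_eq_code {S S' : Sent} (h : S.code = S'.code) :
    S.kind = S'.kind ∧ ∀ i c, (S.sub i c).code = (S'.sub i c).code := by
  obtain ⟨F, ρ⟩ := S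
  obtain ⟨F', ρ'⟩ := S'
  have hh := (F.signedHead_code ρ).unique (F'.signedHead_code ρ') h
  cases F <;> cases F' <;> simp only [NNF.head, Prod.mk.injEq, reduceCtorEq, and_false,
    false_and] at hh <;> clear hh
  case and.and =>
    obtain ⟨h₁, h₂⟩ := andD_inj.1 h
    exact ⟨rfl, fun i _ => by cases i <;> assumption⟩
  case or.or =>
    obtain ⟨h₁, h₂⟩ := andD_inj.1 (negD_inj.1 h)
    exact ⟨rfl, fun i _ => by cases i; exacts [negD_inj.1 h₂, negD_inj.1 h₁]⟩
  case all.all =>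
    -- Equal codes give equal values of the abstractions; applying both to `c` yields equal codes of
    -- the instances.
    exact ⟨rfl, fun _ c => (val_lam _ _ c).symm.trans
      ((congrArg (fun f => app f c) (allD_inj.1 h)).trans (val_lam _ _ c))⟩
  case ex.ex =>
    exact ⟨rfl, fun _ c => negD_inj.1 ((app_lam_negD _ _ c).symm.trans
      ((congrArg (fun f => app f c) (allD_inj.1 (negD_inj.1 h))).trans (app_lam_negD _ _ c)))⟩
  all_goals exact ⟨rfl, fun _ _ => h⟩

theorem code_eq_trD {S : Sent} {b : CTT} (h : S.code = trD b) :
    S.kind = .tr ∧ S.dual.code = negD (trD b) := by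
  obtain ⟨F, ρ⟩ := S
  have hh := (F.signedHead_code ρ).unique (.pos (by simp) (.trD b)) h
  cases F <;> simp [NNF.head] at hh
  exact ⟨rfl, congrArg negD h⟩

theorem code_eq_negD_trD {S : Sent} {b : CTT} (h : S.code = negD (trD b)) :
    S.kind = .ntr ∧ S.dual.code = trD b := by
  obtain ⟨F, ρ⟩ := S
  have hh := (F.signedHead_code ρ).unique (.neg (.trD b)) h
  cases F <;> simp [NNF.head] at hh
  exact ⟨rfl, negD_inj.1 h⟩

end Sent

/-! ## Derivability without lengths -/

/-- Derivability at some rank below `α`. -/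
def Below (α : Ordinal.{0}) (Γ : Sequent) : Prop :=
  ∃ (α₀ : Ordinal.{0}) (_ : α₀ < α) (β γ : Ordinal.{0}), Der α₀ β γ Γ

theorem der_eq (α : Ordinal.{0}) : Der α = Step α (Below α) := by
  funext β γ Γ
  rw [Der]
  rfl

/-- Codes of literals that are axioms at `U`-rank `α`. -/
inductive Ax (α : Ordinal.{0}) : CTT → Prop
  | eq (b : CTT) : Ax α (eqD b b)
  | ne (b c : CTT) : b ≠ c → Ax α (negD (eqD b c))
  | nat (b : CTT) : b.IsNum → Ax α (natD b)
  | nnat (b : CTT) : ¬ b.IsNum → Ax α (negD (natD b))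
  | univ (a b : CTT) : SideCond α (Below α) a b → Proves (Below α) b → Ax α (lev a b)
  | nuniv (a b : CTT) : SideCond α (Below α) a b → ¬ Proves (Below α) b → Ax α (negD (lev a b))

/-- Pairs of a `U`-rank and a `T`-rank, ordered lexicographically. -/
abbrev Rank : Type 1 := Ordinal.{0} ×ₗ Ordinal.{0}

/-- Derivability with given ranks and arbitrary length. -/
inductive Deriv : Rank → Sequent → Prop
  | ax {r : Rank} {Γ : Sequent} (x : CTT) : x ∈ Γ → Ax (ofLex r).1 x → Deriv r Γ
  | log {r : Rank} {Γ : Sequent} (b : CTT) : trD b ∈ Γ → negD (trD b) ∈ Γ → Deriv r Γ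
  | conj {r : Rank} {Γ : Sequent} (S : Sent) : S.code ∈ Γ → S.kind = .conj →
      (∀ i c, Deriv r (insert (S.sub i c).code Γ)) → Deriv r Γ
  | disj {r : Rank} {Γ : Sequent} (S : Sent) (i : Bool) (c : CTT) : S.code ∈ Γ →
      S.kind = .disj → Deriv r (insert (S.sub i c).code Γ) → Deriv r Γ
  | tr {r r₀ : Rank} {Γ : Sequent} {n : ℕ} (A : Fml False True n) (ρ : Fin n → CTT) :
      trD (A.code ρ) ∈ Γ → r₀ < r → Deriv r₀ {(A.nnf true).code ρ} → Deriv r Γ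
  | ntr {r r₀ : Rank} {Γ : Sequent} {n : ℕ} (A : Fml False True n) (ρ : Fin n → CTT) :
      negD (trD (A.code ρ)) ∈ Γ → r₀ < r → Deriv r₀ {(A.nnf false).code ρ} → Deriv r Γ
  | weak {r r₀ : Rank} {Γ : Sequent} : r₀ < r → Deriv r₀ Γ → Deriv r Γ

theorem Step.mono {α : Ordinal.{0}} {P : Sequent → Prop} {β γ : Ordinal.{0}} {Γ : Sequent}
    (h : Step α P β γ Γ) {β' γ' : Ordinal.{0}} (hβ : β ≤ β') (hγ : γ ≤ γ') :
    Step α P β' γ' Γ := by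
  induction h generalizing β' γ' with
  | lit_eq b c h e => exact .lit_eq b c h e
  | lit_ne b c h e => exact .lit_ne b c h e
  | lit_nat b h e => exact .lit_nat b h e
  | lit_nnat b h e => exact .lit_nnat b h e
  | log b h h' => exact .log b h h'
  | and A B ρ h h₀ h₁ _ _ ih₀ ih₁ =>
    exact .and A B ρ h (h₀.trans_le hγ) (h₁.trans_le hγ) (ih₀ hβ le_rfl) (ih₁ hβ le_rfl)
  | or_left A B ρ h h₀ _ ih => exact .or_left A B ρ h (h₀.trans_le hγ) (ih hβ le_rfl)
  | or_right A B ρ h h₀ _ ih => exact .or_right A B ρ h (h₀.trans_le hγ) (ih hβ le_rfl)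
  | ex A ρ a h h₀ _ ih => exact .ex A ρ a h (h₀.trans_le hγ) (ih hβ le_rfl)
  | all A ρ γ₀ h h₀ _ ih =>
    exact .all A ρ γ₀ h (fun a => (h₀ a).trans_le hγ) (fun a => ih a hβ le_rfl)
  | tr A ρ h h₀ h₁ hd _ => exact .tr A ρ h (h₀.trans_le hβ) (h₁.trans_le hγ) hd
  | ntr A ρ h h₀ h₁ hd _ => exact .ntr A ρ h (h₀.trans_le hβ) (h₁.trans_le hγ) hd
  | weak h => exact .weak h
  | univ a b h hs hp => exact .univ a b h hs hp
  | nuniv a b h hs hp => exact .nuniv a b h hs hp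

/-- Lengths only bound the height of a derivation, a role taken over by structural induction on
`Deriv`. -/
theorem Deriv.of_der {α β γ : Ordinal.{0}} {Γ : Sequent} (h : Der α β γ Γ) :
    Deriv (toLex (α, β)) Γ := by
  -- Induction on `Step` alone does not reach the derivations hidden in the predicate for smaller
  -- `U`-ranks, so weakening needs this outer induction.
  induction α using WellFoundedLT.induction generalizing β γ Γ with
  | ind α IH =>
  rw [der_eq] at h
  induction h with
  | lit_eq b c h e => subst e; exact .ax _ h (.eq b)
  | lit_ne b c h e => exact .ax _ h (.ne b c e)
  | lit_nat b h e => exact .ax _ h (.nat b e)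
  | lit_nnat b h e => exact .ax _ h (.nnat b e)
  | log b h h' => exact .log b h h'
  | and A B ρ h h₀ h₁ _ _ ih₀ ih₁ =>
    exact .conj ⟨.and A B, ρ⟩ h rfl fun i _ => by cases i; exacts [ih₁, ih₀]
  | or_left A B ρ h h₀ _ ih => exact .disj ⟨.or A B, ρ⟩ true (CTT.const .k) h rfl ih
  | or_right A B ρ h h₀ _ ih => exact .disj ⟨.or A B, ρ⟩ false (CTT.const .k) h rfl ih
  | ex A ρ a h h₀ _ ih => exact .disj ⟨.ex A, ρ⟩ true a h rfl ih
  | all A ρ γ₀ h h₀ _ ih => exact .conj ⟨.all A, ρ⟩ h rfl fun _ a => ih a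
  | tr A ρ h h₀ h₁ _ ih => exact .tr A ρ h (Prod.Lex.right _ h₀) ih
  | ntr A ρ h h₀ h₁ _ ih => exact .ntr A ρ h (Prod.Lex.right _ h₀) ih
  | weak h =>
    obtain ⟨α₀, h₀, β', γ', h⟩ := h
    exact .weak (Prod.Lex.left _ _ h₀) (IH α₀ h₀ h)
  | univ a b h hs hp => exact .ax _ h (.univ a b hs hp)
  | nuniv a b h hs hp => exact .ax _ h (.nuniv a b hs hp)

theorem der_of_lt {α α₀ β β₀ γ₀ : Ordinal.{0}} {Γ : Sequent} (γ : Ordinal.{0}) (h : α₀ < α)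
    (hd : Der α₀ β₀ γ₀ Γ) : Der α β γ Γ := by
  rw [der_eq]
  exact .weak ⟨α₀, h, β₀, γ₀, hd⟩

/-- The truth rules of `Deriv` may lower the `U`-rank, which the calculus forbids; this is simulated
by a truth rule at the lower rank followed by weakening. -/
theorem Deriv.der {r : Rank} {Γ : Sequent} (h : Deriv r Γ) :
    ∃ γ, Der (ofLex r).1 (ofLex r).2 γ Γ := by
  induction h with
  | ax x hx h =>
    refine ⟨0, ?_⟩
    rw [der_eq]
    cases h with
    | eq b => exact .lit_eq b b hx rfl
    | ne b c h => exact .lit_ne b c hx h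
    | nat b h => exact .lit_nat b hx h
    | nnat b h => exact .lit_nnat b hx h
    | univ a b hs h => exact .univ a b hx hs h
    | nuniv a b hs h => exact .nuniv a b hx hs h
  | log b h h' => exact ⟨0, by rw [der_eq]; exact .log b h h'⟩
  | conj S hS hk _ ih =>
    obtain ⟨F, ρ⟩ := S
    choose g hg using ih
    rw [der_eq] at hg ⊢
    -- The premises are indexed by a small type, so their lengths have a supremum; its successor is
    -- a length for the conclusion.
    have hlt : ∀ i c, g i c < Order.succ (⨆ p : Bool × CTT, g p.1 p.2) := fun i c =>
      Order.lt_succ_of_le (Ordinal.le_iSup (fun p : Bool × CTT => g p.1 p.2) (i, c))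
    cases F with
    | and A B =>
      exact ⟨_, .and A B ρ hS (hlt true (CTT.const .k)) (hlt false (CTT.const .k))
        (hg true _) (hg false _)⟩
    | all A => exact ⟨_, .all A ρ (g true) hS (hlt true) (hg true)⟩
    | _ => cases hk
  | disj S i c hS hk _ ih =>
    obtain ⟨F, ρ⟩ := S
    obtain ⟨γ, hγ⟩ := ih
    rw [der_eq] at hγ ⊢
    cases F with
    | or A B =>
      cases i
      · exact ⟨_, .or_right A B ρ hS (Order.lt_succ γ) hγ⟩
      · exact ⟨_, .or_left A B ρ hS (Order.lt_succ γ) hγ⟩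
    | ex A => exact ⟨_, .ex A ρ c hS (Order.lt_succ γ) hγ⟩
    | _ => cases hk
  | @tr _ r₀ _ _ A ρ h hr _ ih =>
    obtain ⟨γ, hγ⟩ := ih
    rcases Prod.Lex.lt_iff.1 hr with hlt | ⟨heq, hlt⟩
    -- The premise has a smaller `U`-rank: the rule is applied there with the next `T`-rank, and
    -- weakening then reaches the required rank with any `T`-rank and length.
    · refine ⟨0, der_of_lt (β₀ := Order.succ (ofLex r₀).2) (γ₀ := Order.succ γ) 0 hlt ?_⟩
      rw [der_eq] at hγ ⊢
      exact .tr A ρ h (Order.lt_succ _) (Order.lt_succ γ) hγ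
    · refine ⟨Order.succ γ, ?_⟩
      rw [heq] at hγ
      rw [der_eq] at hγ ⊢
      exact .tr A ρ h hlt (Order.lt_succ γ) hγ
  | @ntr _ r₀ _ _ A ρ h hr _ ih =>
    obtain ⟨γ, hγ⟩ := ih
    rcases Prod.Lex.lt_iff.1 hr with hlt | ⟨heq, hlt⟩
    · refine ⟨0, der_of_lt (β₀ := Order.succ (ofLex r₀).2) (γ₀ := Order.succ γ) 0 hlt ?_⟩
      rw [der_eq] at hγ ⊢
      exact .ntr A ρ h (Order.lt_succ _) (Order.lt_succ γ) hγ
    · refine ⟨Order.succ γ, ?_⟩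
      rw [heq] at hγ
      rw [der_eq] at hγ ⊢
      exact .ntr A ρ h hlt (Order.lt_succ γ) hγ
  | weak hr _ ih =>
    obtain ⟨γ, hγ⟩ := ih
    rcases Prod.Lex.lt_iff.1 hr with hlt | ⟨heq, hlt⟩
    · exact ⟨0, der_of_lt 0 hlt hγ⟩
    · refine ⟨γ, ?_⟩
      rw [heq] at hγ
      rw [der_eq] at hγ ⊢
      exact hγ.mono hlt.le le_rfl

theorem Deriv.mono_rank {r r' : Rank} {Γ : Sequent} (h : Deriv r Γ) (hr : r ≤ r') :
    Deriv r' Γ := by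
  rcases hr.eq_or_lt with rfl | hr
  · exact h
  · exact .weak hr h

theorem Deriv.mono {r : Rank} {Γ Γ' : Sequent} (h : Deriv r Γ) (hΓ : Γ ⊆ Γ') : Deriv r Γ' := by
  induction h generalizing Γ' with
  | ax x hx h => exact .ax x (hΓ hx) h
  | log b h h' => exact .log b (hΓ h) (hΓ h')
  | conj S hS hk _ ih =>
    exact .conj S (hΓ hS) hk fun i c => ih i c (Finset.insert_subset_insert _ hΓ)
  | disj S i c hS hk _ ih => exact .disj S i c (hΓ hS) hk (ih (Finset.insert_subset_insert _ hΓ))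
  | tr A ρ h hr hd _ => exact .tr A ρ (hΓ h) hr hd
  | ntr A ρ h hr hd _ => exact .ntr A ρ (hΓ h) hr hd
  | weak hr _ ih => exact .weak hr (ih hΓ)

/-- Every rule except weakening needs a member of the sequent as its principal formula. Together
with cut this is consistency. -/
theorem Deriv.not_empty {r : Rank} {Γ : Sequent} (h : Deriv r Γ) : Γ ≠ ∅ := by
  induction h with
  | weak _ _ ih => exact ih
  | _ => rintro rfl; simp_all

/-! ## Similarity of codes -/

/-- Similar codes belong to sentences that differ only in the codes of their quantified parts, as
long as all instances are similar. -/
inductive Sim : CTT → CTT → Prop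
  | refl (x : CTT) : Sim x x
  | conj (S S' : Sent) : S.kind = .conj → S'.kind = .conj →
      (∀ i c, Sim (S.sub i c).code (S'.sub i c).code) → Sim S.code S'.code
  | disj (S S' : Sent) : S.kind = .disj → S'.kind = .disj →
      (∀ i c, Sim (S.sub i c).code (S'.sub i c).code) → Sim S.code S'.code

theorem Sim.of_eq {x y : CTT} (h : x = y) : Sim x y := h ▸ .refl x

theorem Sim.symm {x y : CTT} (h : Sim x y) : Sim y x := by
  induction h with
  | refl x => exact .refl x
  | conj S S' h h' _ ih => exact .conj S' S h' h ih
  | disj S S' h h' _ ih => exact .disj S' S h' h ih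

/-- Codes of literals have a distinguished outermost constructor. -/
def IsLitCode (x : CTT) : Prop :=
  ∃ i : Bool × Const, SignedHead i x ∧ (i.2 = .eqD ∨ i.2 = .natD ∨ i.2 = .l ∨ i.2 = .trD)

theorem Sent.kind_of_isLitCode {S : Sent} (h : IsLitCode S.code) :
    S.kind ≠ .conj ∧ S.kind ≠ .disj := by
  obtain ⟨F, ρ⟩ := S
  obtain ⟨i, hi, h⟩ := h
  rw [hi.unique (F.signedHead_code ρ) rfl] at h
  cases F <;> simp_all [NNF.head, Sent.kind]

theorem Ax.signedHead {α : Ordinal.{0}} {x : CTT} (h : Ax α x) :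
    ∃ i : Bool × Const, SignedHead i x ∧ (i.2 = .eqD ∨ i.2 = .natD ∨ i.2 = .l) := by
  cases h with
  | eq b => exact ⟨_, .pos (by simp) (.eqD _ _), by simp⟩
  | ne b c h => exact ⟨_, .neg (.eqD _ _), by simp⟩
  | nat b h => exact ⟨_, .pos (by simp) (.natD _), by simp⟩
  | nnat b h => exact ⟨_, .neg (.natD _), by simp⟩
  | univ a b hs h => exact ⟨_, .pos (by simp) (.lev _ _), by simp⟩
  | nuniv a b hs h => exact ⟨_, .neg (.lev _ _), by simp⟩

theorem Ax.isLitCode {α : Ordinal.{0}} {x : CTT} (h : Ax α x) : IsLitCode x := by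
  obtain ⟨i, hi, h⟩ := h.signedHead
  exact ⟨i, hi, by tauto⟩

theorem Ax.kind {α : Ordinal.{0}} {S : Sent} (h : Ax α S.code) : S.kind = .lit := by
  obtain ⟨F, ρ⟩ := S
  obtain ⟨i, hi, h⟩ := h.signedHead
  rw [hi.unique (F.signedHead_code ρ) rfl] at h
  cases F <;> simp_all [NNF.head, Sent.kind]

theorem isLitCode_trD (b : CTT) : IsLitCode (trD b) := ⟨_, .pos (by simp) (.trD b), by simp⟩

theorem isLitCode_negD_trD (b : CTT) : IsLitCode (negD (trD b)) := ⟨_, .neg (.trD b), by simp⟩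

theorem Sim.eq_of_isLitCode {x y : CTT} (h : Sim x y) (hx : IsLitCode x) : x = y := by
  cases h with
  | refl => rfl
  | conj S S' h => exact ((Sent.kind_of_isLitCode hx).1 h).elim
  | disj S S' h => exact ((Sent.kind_of_isLitCode hx).2 h).elim

/-- A code may come from several sentences, and `Sim` need not have been built from the given `S`.
`Sent.code_eq_code` transfers the kind and the instances to `S`. -/
theorem Sim.inv {S : Sent} {x y : CTT} (h : Sim x y) (e : x = S.code) :
    y = S.code ∨ ∃ S' : Sent, S'.kind = S.kind ∧ y = S'.code ∧
      ∀ i c, Sim (S.sub i c).code (S'.sub i c).code := by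
  cases h with
  | refl => exact .inl e
  | conj S₁ S' h h' hs =>
    obtain ⟨hk, hc⟩ := Sent.code_eq_code e
    exact .inr ⟨S', by rw [h', ← hk, h], rfl, fun i c => hc i c ▸ hs i c⟩
  | disj S₁ S' h h' hs =>
    obtain ⟨hk, hc⟩ := Sent.code_eq_code e
    exact .inr ⟨S', by rw [h', ← hk, h], rfl, fun i c => hc i c ▸ hs i c⟩

/-- Derivability is invariant under similarity. -/
theorem Deriv.sim {r : Rank} {Δ Γ : Sequent} (h : Deriv r Δ) (H : ∀ x ∈ Δ, ∃ y ∈ Γ, Sim x y) :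
    Deriv r Γ := by
  -- A literal is similar only to itself, so axioms and truth rules carry over unchanged.
  have lit : ∀ {Δ Γ : Sequent}, (∀ x ∈ Δ, ∃ y ∈ Γ, Sim x y) → ∀ {x}, x ∈ Δ → IsLitCode x →
      x ∈ Γ := by
    intro Δ Γ H x hx hl
    obtain ⟨y, hy, hs⟩ := H x hx
    rwa [hs.eq_of_isLitCode hl]
  have ext : ∀ {Δ Γ : Sequent}, (∀ x ∈ Δ, ∃ y ∈ Γ, Sim x y) → ∀ {x y}, Sim x y →
      ∀ z ∈ insert x Δ, ∃ w ∈ insert y Γ, Sim z w := by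
    intro Δ Γ H x y hs z hz
    rcases Finset.mem_insert.1 hz with rfl | hz
    · exact ⟨y, Finset.mem_insert_self _ _, hs⟩
    · obtain ⟨w, hw, h⟩ := H z hz
      exact ⟨w, Finset.mem_insert_of_mem hw, h⟩
  induction h generalizing Γ with
  | ax x hx h => exact .ax x (lit H hx h.isLitCode) h
  | log b h h' =>
    exact .log b (lit H h (isLitCode_trD b)) (lit H h' (isLitCode_negD_trD b))
  | conj S hS hk _ ih =>
    obtain ⟨y, hy, hs⟩ := H _ hS
    rcases hs.inv rfl with rfl | ⟨S', hk', rfl, hs'⟩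
    · exact .conj S hy hk fun i c => ih i c (ext H (.refl _))
    · exact .conj S' hy (hk'.trans hk) fun i c => ih i c (ext H (hs' i c))
  | disj S i c hS hk _ ih =>
    obtain ⟨y, hy, hs⟩ := H _ hS
    rcases hs.inv rfl with rfl | ⟨S', hk', rfl, hs'⟩
    · exact .disj S i c hy hk (ih (ext H (.refl _)))
    · exact .disj S' i c hy (hk'.trans hk) (ih (ext H (hs' i c)))
  | tr A ρ h hr hd _ => exact .tr A ρ (lit H h (isLitCode_trD _)) hr hd
  | ntr A ρ h hr hd _ => exact .ntr A ρ (lit H h (isLitCode_negD_trD _)) hr hd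
  | weak hr _ ih => exact .weak hr (ih H)

theorem Deriv.sim_singleton {r : Rank} {x y : CTT} (h : Deriv r {x}) (hs : Sim x y) :
    Deriv r {y} :=
  h.sim fun z hz => ⟨y, by simp, by rwa [Finset.mem_singleton.1 hz]⟩

namespace Sim

theorem and {n m : ℕ} {A B : NNF n} {ρ : Fin n → CTT} {A' B' : NNF m} {ρ' : Fin m → CTT}
    (hA : Sim (A.code ρ) (A'.code ρ')) (hB : Sim (B.code ρ) (B'.code ρ')) :
    Sim ((NNF.and A B).code ρ) ((NNF.and A' B').code ρ') :=
  .conj ⟨.and A B, ρ⟩ ⟨.and A' B', ρ'⟩ rfl rfl fun i _ => by cases i; exacts [hB, hA]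

theorem or {n m : ℕ} {A B : NNF n} {ρ : Fin n → CTT} {A' B' : NNF m} {ρ' : Fin m → CTT}
    (hA : Sim (A.code ρ) (A'.code ρ')) (hB : Sim (B.code ρ) (B'.code ρ')) :
    Sim ((NNF.or A B).code ρ) ((NNF.or A' B').code ρ') :=
  .disj ⟨.or A B, ρ⟩ ⟨.or A' B', ρ'⟩ rfl rfl fun i _ => by cases i; exacts [hB, hA]

theorem all {n m : ℕ} {A : NNF (n + 1)} {ρ : Fin n → CTT} {A' : NNF (m + 1)} {ρ' : Fin m → CTT}
    (h : ∀ c, Sim (A.code (Fin.cons c ρ)) (A'.code (Fin.cons c ρ'))) :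
    Sim ((NNF.all A).code ρ) ((NNF.all A').code ρ') :=
  .conj ⟨.all A, ρ⟩ ⟨.all A', ρ'⟩ rfl rfl fun _ c => h c

theorem ex {n m : ℕ} {A : NNF (n + 1)} {ρ : Fin n → CTT} {A' : NNF (m + 1)} {ρ' : Fin m → CTT}
    (h : ∀ c, Sim (A.code (Fin.cons c ρ)) (A'.code (Fin.cons c ρ'))) :
    Sim ((NNF.ex A).code ρ) ((NNF.ex A').code ρ') :=
  .disj ⟨.ex A, ρ⟩ ⟨.ex A', ρ'⟩ rfl rfl fun _ c => h c

end Sim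

/-! ## Sentence codes determine derivability -/

namespace Fml

variable {n : ℕ} (ρ : Fin n → CTT)

/-- The outermost constructor of the code of a formula. -/
def head {n : ℕ} : Fml False True n → Const
  | eq _ _ => .eqD
  | nat _ => .natD
  | tr _ => .trD
  | univ h _ => h.elim
  | lev _ _ _ => .l
  | neg _ => .negD
  | and _ _ => .andD
  | imp _ _ => .impD
  | all _ => .allD

theorem head_code (A : Fml False True n) : Head A.head (A.code ρ) := by
  cases A with
  | eq s t => exact .eqD _ _
  | nat s => exact .natD _
  | tr s => exact .trD _
  | univ h => exact h.elim
  | lev _ a b => exact .lev _ _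
  | neg A => exact .negD _
  | and A B => exact .andD _ _
  | imp A B => exact .impD _ _
  | all A => exact .allD _

/-- Equal codes determine the connectives step by step. Under a quantifier only the instances can be
compared: the abstractions of the normal forms need not be equal, which is why the conclusion is
similarity rather than equality. -/
theorem sim_nnf {n m : ℕ} (A : Fml False True n) (A' : Fml False True m) {ρ : Fin n → CTT}
    {ρ' : Fin m → CTT} (h : A.code ρ = A'.code ρ') (i : Bool) :
    Sim ((A.nnf i).code ρ) ((A'.nnf i).code ρ') := by
  have neg_of_eq : ∀ {x y : CTT}, x = y → Sim (negD x) (negD y) := fun e => .of_eq (congrArg negD e)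
  induction A generalizing m i with
  | univ hu => exact hu.elim
  | eq s t =>
    have hh := (head_code ρ _).unique (head_code ρ' A') h
    cases A' <;> simp only [head, reduceCtorEq] at hh
    case univ hu _ => exact hu.elim
    clear hh
    cases i
    exacts [neg_of_eq h, .of_eq h]
  | nat s =>
    have hh := (head_code ρ _).unique (head_code ρ' A') h
    cases A' <;> simp only [head, reduceCtorEq] at hh
    case univ hu _ => exact hu.elim
    clear hh
    cases i
    exacts [neg_of_eq h, .of_eq h]
  | tr s =>
    have hh := (head_code ρ _).unique (head_code ρ' A') h
    cases A' <;> simp only [head, reduceCtorEq] at hh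
    case univ hu _ => exact hu.elim
    clear hh
    cases i
    exacts [neg_of_eq h, .of_eq h]
  | lev _ a b =>
    have hh := (head_code ρ _).unique (head_code ρ' A') h
    cases A' <;> simp only [head, reduceCtorEq] at hh
    case univ hu _ => exact hu.elim
    clear hh
    cases i
    exacts [neg_of_eq h, .of_eq h]
  | neg A ih =>
    have hh := (head_code ρ _).unique (head_code ρ' A') h
    cases A' <;> simp only [head, reduceCtorEq] at hh
    case univ hu _ => exact hu.elim
    clear hh
    cases i
    exacts [ih _ (negD_inj.1 h) _, ih _ (negD_inj.1 h) _]
  | and A B ihA ihB =>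
    have hh := (head_code ρ _).unique (head_code ρ' A') h
    cases A' <;> simp only [head, reduceCtorEq] at hh
    case univ hu _ => exact hu.elim
    clear hh
    obtain ⟨hA, hB⟩ := andD_inj.1 h
    cases i
    exacts [.or (ihA _ hA _) (ihB _ hB _), .and (ihA _ hA _) (ihB _ hB _)]
  | imp A B ihA ihB =>
    have hh := (head_code ρ _).unique (head_code ρ' A') h
    cases A' <;> simp only [head, reduceCtorEq] at hh
    case univ hu _ => exact hu.elim
    clear hh
    obtain ⟨hA, hB⟩ := impD_inj.1 h
    cases i
    exacts [.and (ihA _ hA _) (ihB _ hB _), .or (ihA _ hA _) (ihB _ hB _)]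
  | all A ih =>
    have hh := (head_code ρ _).unique (head_code ρ' A') h
    cases A' <;> simp only [head, reduceCtorEq] at hh
    case univ hu _ => exact hu.elim
    clear hh
    have hc := fun c => (val_lam _ _ c).symm.trans
      ((congrArg (fun f => app f c) (allD_inj.1 h)).trans (val_lam _ _ c))
    cases i
    exacts [.ex fun c => ih _ (hc c) _, .all fun c => ih _ (hc c) _]

/-- A code of the form `¬̇ x` is the code of a negation. -/
theorem code_eq_negD {A : Fml False True n} {x : CTT} (h : A.code ρ = negD x) :
    ∃ B : Fml False True n, A = .neg B ∧ B.code ρ = x := by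
  have hh := (head_code ρ A).unique (.negD x) h
  cases A <;> simp only [head, reduceCtorEq] at hh
  case univ hu _ => exact hu.elim
  exact ⟨_, rfl, negD_inj.1 h⟩

end Fml

/-! ## Cut elimination -/

/-- A last inference of a derivation at rank `r` with principal formula `x`. -/
inductive Principal (r : Rank) (x : CTT) (Γ : Sequent) : Prop
  | ax (α : Ordinal.{0}) : Ax α x → Principal r x Γ
  | log (b : CTT) : x = trD b → negD (trD b) ∈ Γ → Principal r x Γ
  | nlog (b : CTT) : x = negD (trD b) → trD b ∈ Γ → Principal r x Γ
  | conj (S : Sent) : x = S.code → S.kind = .conj →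
      (∀ i c, Deriv r (insert (S.sub i c).code Γ)) → Principal r x Γ
  | disj (S : Sent) (i : Bool) (c : CTT) : x = S.code → S.kind = .disj →
      Deriv r (insert (S.sub i c).code Γ) → Principal r x Γ
  | tr {r₀ : Rank} {n : ℕ} (A : Fml False True n) (ρ : Fin n → CTT) : x = trD (A.code ρ) →
      r₀ < r → Deriv r₀ {(A.nnf true).code ρ} → Principal r x Γ
  | ntr {r₀ : Rank} {n : ℕ} (A : Fml False True n) (ρ : Fin n → CTT) :
      x = negD (trD (A.code ρ)) → r₀ < r → Deriv r₀ {(A.nnf false).code ρ} → Principal r x Γ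

theorem Principal.mono {r : Rank} {x : CTT} {Γ Γ' : Sequent} (h : Principal r x Γ)
    (hΓ : Γ ⊆ Γ') : Principal r x Γ' := by
  cases h with
  | ax α h => exact .ax α h
  | log b e h => exact .log b e (hΓ h)
  | nlog b e h => exact .nlog b e (hΓ h)
  | conj S e hk h => exact .conj S e hk fun i c => (h i c).mono (Finset.insert_subset_insert _ hΓ)
  | disj S i c e hk h => exact .disj S i c e hk (h.mono (Finset.insert_subset_insert _ hΓ))
  | tr A ρ e hr h => exact .tr A ρ e hr h
  | ntr A ρ e hr h => exact .ntr A ρ e hr h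

/-- To remove a formula from a derivation, it suffices to treat inferences with that principal
formula. -/
theorem Deriv.elim {r r₁ : Rank} {Δ Γ₀ : Sequent} {x : CTT} (h : Deriv r₁ Δ) (hr : r₁ ≤ r)
    (H : ∀ Γ, Γ₀ ⊆ Γ → Principal r x Γ → Deriv r Γ) {Γ : Sequent} (h₀ : Γ₀ ⊆ Γ)
    (hΔ : Δ ⊆ insert x Γ) : Deriv r Γ := by
  have ext : ∀ {Δ Γ : Sequent} (y : CTT), Δ ⊆ insert x Γ → insert y Δ ⊆ insert x (insert y Γ) :=
    fun y h => by rw [Finset.insert_comm]; exact Finset.insert_subset_insert _ h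
  have sub : ∀ {Γ : Sequent} (y : CTT), Γ₀ ⊆ Γ → Γ₀ ⊆ insert y Γ :=
    fun y h => h.trans (Finset.subset_insert _ _)
  -- Side formulas accumulate towards the leaves, so `H` is needed for every context containing
  -- `Γ₀`. The bound `r₁ ≤ r` absorbs weakening, which lowers the rank.
  induction h generalizing Γ with
  | ax y hy h =>
    rcases Finset.mem_insert.1 (hΔ hy) with rfl | hy'
    · exact H Γ h₀ (.ax _ h)
    · exact Deriv.mono_rank (.ax _ hy' h) hr
  | log b h h' =>
    rcases Finset.mem_insert.1 (hΔ h) with e | h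
    · rcases Finset.mem_insert.1 (hΔ h') with e' | h'
      · cases (Head.trD b).unique (.negD _) (e.trans e'.symm)
      · exact H Γ h₀ (.log b e.symm h')
    · rcases Finset.mem_insert.1 (hΔ h') with e' | h'
      · exact H Γ h₀ (.nlog b e'.symm h)
      · exact .log b h h'
  | conj S hS hk _ ih =>
    have ih := fun i c => ih i c hr (sub _ h₀) (ext _ hΔ)
    rcases Finset.mem_insert.1 (hΔ hS) with e | hS
    · exact H Γ h₀ (.conj S e.symm hk ih)
    · exact .conj S hS hk ih
  | disj S i c hS hk _ ih =>
    have ih := ih hr (sub _ h₀) (ext _ hΔ)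
    rcases Finset.mem_insert.1 (hΔ hS) with e | hS
    · exact H Γ h₀ (.disj S i c e.symm hk ih)
    · exact .disj S i c hS hk ih
  | tr A ρ h hr₀ hd _ =>
    rcases Finset.mem_insert.1 (hΔ h) with e | h
    · exact H Γ h₀ (.tr A ρ e.symm (hr₀.trans_le hr) hd)
    · exact .tr A ρ h (hr₀.trans_le hr) hd
  | ntr A ρ h hr₀ hd _ =>
    rcases Finset.mem_insert.1 (hΔ h) with e | h
    · exact H Γ h₀ (.ntr A ρ e.symm (hr₀.trans_le hr) hd)
    · exact .ntr A ρ h (hr₀.trans_le hr) hd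
  | weak hr₀ _ ih => exact ih (hr₀.le.trans hr) h₀ hΔ

theorem Ax.deriv {α : Ordinal.{0}} {x : CTT} (h : Ax α x) : Deriv (toLex (α, 0)) {x} :=
  .ax x (Finset.mem_singleton_self x) h

theorem Ax.below {α α' : Ordinal.{0}} {x : CTT} (h : Ax α x) (hα : α < α') : Below α' {x} := by
  obtain ⟨γ, hγ⟩ := h.deriv.der
  exact ⟨α, hα, _, γ, hγ⟩

/-- Literals in `=` and `N` are axioms only if true. For `L` the condition that `L_a(b)` is
undecided below prevents two ranks from deciding it differently. -/
theorem Ax.consistent {α α' : Ordinal.{0}} {x : CTT} (h : Ax α x) (h' : Ax α' (negD x)) :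
    False := by
  have hx := h'
  generalize e : negD x = y at h'
  cases h' with
  | eq b => cases (Head.negD x).unique (.eqD _ _) e
  | nat b => cases (Head.negD x).unique (.natD _) e
  | univ a b => cases (Head.negD x).unique (.lev _ _) e
  | ne b c hbc =>
    have e := negD_inj.1 e
    cases h with
    | eq d => exact hbc ((eqD_inj.1 e).1.symm.trans (eqD_inj.1 e).2)
    | nat => cases Head.unique (.natD _) (.eqD _ _) e
    | univ => cases Head.unique (.lev _ _) (.eqD _ _) e
    | _ => cases Head.unique (.negD _) (.eqD _ _) e
  | nnat b hb =>
    have e := negD_inj.1 e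
    cases h with
    | eq d => cases Head.unique (.eqD _ _) (.natD _) e
    | nat c hc => exact hb (natD_inj.1 e ▸ hc)
    | univ => cases Head.unique (.lev _ _) (.natD _) e
    | _ => cases Head.unique (.negD _) (.natD _) e
  | nuniv a b hs hp =>
    have e := negD_inj.1 e
    have h₀ := h
    cases h with
    | eq d => cases Head.unique (.eqD _ _) (.lev _ _) e
    | nat => cases Head.unique (.natD _) (.lev _ _) e
    | univ a' b' hs' hp' =>
      obtain ⟨rfl, rfl⟩ := lev_inj.1 e
      -- At equal ranks the provability conditions on `b` contradict each other; otherwise the lower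
      -- axiom violates the side condition of the higher one.
      rcases lt_trichotomy α α' with hlt | rfl | hlt
      · exact hs.2.2.1 (h₀.below hlt)
      · exact hp hp'
      · exact hs'.2.2.2 (hx.below hlt)
    | _ => cases Head.unique (.negD _) (.lev _ _) e

theorem Sent.code_dual_of_lit {S : Sent} (h : S.kind = .lit) :
    S.dual.code = negD S.code ∨ S.code = negD S.dual.code := by
  obtain ⟨F, ρ⟩ := S
  cases F <;> first | exact .inl rfl | exact .inr rfl | cases h

theorem NNF.dual_dual {n : ℕ} (F : NNF n) : F.dual.dual = F := by
  induction F <;> simp_all [NNF.dual]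

theorem Sent.dual_dual (S : Sent) : S.dual.dual = S := by
  simp [Sent.dual, NNF.dual_dual]

theorem Sent.size_dual (S : Sent) : S.dual.formula.size = S.formula.size := by
  obtain ⟨F, ρ⟩ := S
  change F.dual.size = F.size
  clear ρ
  induction F <;> simp_all [NNF.dual, NNF.size]

/-- The code fixes the kind of each cut formula, so inferences of non-dual kinds cannot meet. The
logical axiom makes one cut formula a member of `Γ`, conjunctive against disjunctive reduces the
size, and `T` against `¬T` reduces the rank. -/
theorem Deriv.cut_principal {r : Rank} {S : Sent} {Γ : Sequent}
    (IHr : ∀ r₀ < r, ∀ (S : Sent) (Γ : Sequent), Deriv r₀ (insert S.code Γ) →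
      Deriv r₀ (insert S.dual.code Γ) → Deriv r₀ Γ)
    (IHs : ∀ S' : Sent, S'.formula.size < S.formula.size → ∀ Γ : Sequent,
      Deriv r (insert S'.code Γ) → Deriv r (insert S'.dual.code Γ) → Deriv r Γ)
    (h : Deriv r (insert S.code Γ)) (h' : Deriv r (insert S.dual.code Γ))
    (p : Principal r S.code Γ) (p' : Principal r S.dual.code Γ) : Deriv r Γ := by
  have of_mem : S.dual.code ∈ Γ → Deriv r Γ := fun hm => by rwa [Finset.insert_eq_of_mem hm] at h'
  have of_mem' : S.code ∈ Γ → Deriv r Γ := fun hm => by rwa [Finset.insert_eq_of_mem hm] at h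
  have hd := S.kind_dual
  -- The truth rules discard the context, so their premises are single sentences, dual up to
  -- similarity. Both ranks are below `r`, and a cut at their maximum would derive the empty
  -- sequent. The size of `A` is irrelevant.
  have tr_ntr : ∀ {r₁ r₂ : Rank} {n m : ℕ} (A : Fml False True n) (ρ : Fin n → CTT)
      (B : Fml False True m) (ρ' : Fin m → CTT), A.code ρ = B.code ρ' → r₁ < r → r₂ < r →
      Deriv r₁ {(A.nnf true).code ρ} → Deriv r₂ {(B.nnf false).code ρ'} → Deriv r Γ := by
    intro r₁ r₂ n m A ρ B ρ' e h₁ h₂ d₁ d₂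
    have d₂ := d₂.sim_singleton ((Fml.sim_nnf A B e false).symm)
    have := IHr (max r₁ r₂) (max_lt h₁ h₂) ⟨A.nnf true, ρ⟩ ∅ (d₁.mono_rank (le_max_left _ _))
      (by simpa [Sent.dual, Sent.code, Fml.dual_nnf] using d₂.mono_rank (le_max_right _ _))
    exact (this.not_empty rfl).elim
  have conj_disj : ∀ S₁ : Sent, S₁.kind = .conj →
      (∀ S' : Sent, S'.formula.size < S₁.formula.size → ∀ Γ : Sequent,
        Deriv r (insert S'.code Γ) → Deriv r (insert S'.dual.code Γ) → Deriv r Γ) →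
      ∀ (S₂ S₃ : Sent) (i : Bool) (c : CTT), S₁.code = S₂.code → S₁.dual.code = S₃.code →
      (∀ i c, Deriv r (insert (S₂.sub i c).code Γ)) → Deriv r (insert (S₃.sub i c).code Γ) →
      Deriv r Γ := by
    intro S₁ hk IH S₂ S₃ i c e₂ e₃ d₂ d₃
    refine IH (S₁.sub i c) (S₁.size_sub i c (.inl hk)) Γ ?_ ?_
    · rw [(Sent.code_eq_code e₂).2]
      exact d₂ i c
    · rw [← S₁.sub_dual i c (.inl hk), (Sent.code_eq_code e₃).2]
      exact d₃
  cases p with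
  | log b e hm => exact of_mem ((Sent.code_eq_trD e).2 ▸ hm)
  | nlog b e hm => exact of_mem ((Sent.code_eq_negD_trD e).2 ▸ hm)
  | ax α hx =>
    have hk := hx.kind
    rw [hk] at hd
    cases p' with
    | log b e hm => simp [(Sent.code_eq_trD e).1, Kind.dual] at hd
    | nlog b e hm => simp [(Sent.code_eq_negD_trD e).1, Kind.dual] at hd
    | ax α' hx' =>
      rcases Sent.code_dual_of_lit hk with e | e
      · exact (hx.consistent (e ▸ hx')).elim
      · exact (hx'.consistent (e ▸ hx)).elim
    | conj S' e hk' => simp [(Sent.code_eq_code e).1, hk', Kind.dual] at hd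
    | disj S' _ _ e hk' => simp [(Sent.code_eq_code e).1, hk', Kind.dual] at hd
    | tr A ρ e => simp [(Sent.code_eq_trD e).1, Kind.dual] at hd
    | ntr A ρ e => simp [(Sent.code_eq_negD_trD e).1, Kind.dual] at hd
  | conj S₁ e₁ hk₁ d₁ =>
    have hk := (Sent.code_eq_code e₁).1.trans hk₁
    rw [hk] at hd
    cases p' with
    | log b e hm => simp [(Sent.code_eq_trD e).1, Kind.dual] at hd
    | nlog b e hm => simp [(Sent.code_eq_negD_trD e).1, Kind.dual] at hd
    | ax α' hx' => simp [hx'.kind, Kind.dual] at hd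
    | conj S' e hk' => simp [(Sent.code_eq_code e).1, hk', Kind.dual] at hd
    | disj S₂ i c e₂ hk₂ d₂ => exact conj_disj S hk IHs S₁ S₂ i c e₁ e₂ d₁ d₂
    | tr A ρ e => simp [(Sent.code_eq_trD e).1, Kind.dual] at hd
    | ntr A ρ e => simp [(Sent.code_eq_negD_trD e).1, Kind.dual] at hd
  | disj S₁ i c e₁ hk₁ d₁ =>
    have hk := (Sent.code_eq_code e₁).1.trans hk₁
    rw [hk] at hd
    cases p' with
    | log b e hm => simp [(Sent.code_eq_trD e).1, Kind.dual] at hd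
    | nlog b e hm => simp [(Sent.code_eq_negD_trD e).1, Kind.dual] at hd
    | ax α' hx' => simp [hx'.kind, Kind.dual] at hd
    | conj S₂ e₂ hk₂ d₂ =>
      -- The roles of the two sides are exchanged; dualizing preserves sizes, so the same induction
      -- hypothesis applies.
      refine conj_disj S.dual hd (fun S' hS' Γ d d' => ?_) S₂ S₁ i c e₂
        (by rw [Sent.dual_dual, e₁]) d₂ d₁
      exact IHs S' (by rwa [Sent.size_dual] at hS') Γ d d'
    | disj S' _ _ e hk' => simp [(Sent.code_eq_code e).1, hk', Kind.dual] at hd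
    | tr A ρ e => simp [(Sent.code_eq_trD e).1, Kind.dual] at hd
    | ntr A ρ e => simp [(Sent.code_eq_negD_trD e).1, Kind.dual] at hd
  | tr A ρ e hr d =>
    obtain ⟨hk, e'⟩ := Sent.code_eq_trD e
    rw [hk] at hd
    cases p' with
    | log b e hm => simp [(Sent.code_eq_trD e).1, Kind.dual] at hd
    | nlog b e₁ hm =>
      rw [e'] at e₁
      exact of_mem' (by rw [e, negD_inj.1 e₁]; exact hm)
    | ax α' hx' => simp [hx'.kind, Kind.dual] at hd
    | conj S' e hk' => simp [(Sent.code_eq_code e).1, hk', Kind.dual] at hd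
    | disj S' _ _ e hk' => simp [(Sent.code_eq_code e).1, hk', Kind.dual] at hd
    | tr A ρ e => simp [(Sent.code_eq_trD e).1, Kind.dual] at hd
    | ntr B ρ' e₁ hr' d' =>
      rw [e'] at e₁
      exact tr_ntr A ρ B ρ' (trD_inj.1 (negD_inj.1 e₁)) hr hr' d d'
  | ntr A ρ e hr d =>
    obtain ⟨hk, e'⟩ := Sent.code_eq_negD_trD e
    rw [hk] at hd
    cases p' with
    | log b e₁ hm =>
      rw [e'] at e₁
      exact of_mem' (by rw [e, e₁]; exact hm)
    | nlog b e hm => simp [(Sent.code_eq_negD_trD e).1, Kind.dual] at hd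
    | ax α' hx' => simp [hx'.kind, Kind.dual] at hd
    | conj S' e hk' => simp [(Sent.code_eq_code e).1, hk', Kind.dual] at hd
    | disj S' _ _ e hk' => simp [(Sent.code_eq_code e).1, hk', Kind.dual] at hd
    | tr B ρ' e₁ hr' d' =>
      rw [e'] at e₁
      exact tr_ntr B ρ' A ρ (trD_inj.1 e₁).symm hr' hr d' d
    | ntr A ρ e => simp [(Sent.code_eq_negD_trD e).1, Kind.dual] at hd

/-- Cut is admissible. -/
theorem Deriv.cut {r : Rank} (S : Sent) (Γ : Sequent) (h : Deriv r (insert S.code Γ))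
    (h' : Deriv r (insert S.dual.code Γ)) : Deriv r Γ := by
  induction r using WellFoundedLT.induction generalizing S Γ with
  | ind r IHr =>
  induction hs : S.formula.size using Nat.strong_induction_on generalizing S Γ with
  | _ s IHs =>
  subst hs
  -- Two nested eliminations: each inference of the first derivation with principal formula `S` is
  -- confronted with each inference of the second whose principal formula is the dual. Only this
  -- doubly principal case remains.
  refine h.elim le_rfl (Γ₀ := Γ) (fun Γ₁ h₁ p => ?_) le_rfl le_rfl
  refine h'.elim le_rfl (Γ₀ := Γ₁) (fun Γ₂ h₂ p' => ?_) le_rfl (Finset.insert_subset_insert _ h₁)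
  refine cut_principal IHr (fun S' hS' Γ d d' => IHs _ hS' S' Γ d d' rfl)
    (h.mono (Finset.insert_subset_insert _ (h₁.trans h₂)))
    (h'.mono (Finset.insert_subset_insert _ (h₁.trans h₂))) (p.mono h₂) p'

/-! ## Derivability at a fixed `U`-rank -/

/-- Derivability at `U`-rank `α`, with arbitrary `T`-rank and length. -/
def At (α : Ordinal.{0}) (Γ : Sequent) : Prop := ∃ β : Ordinal.{0}, Deriv (toLex (α, β)) Γ

theorem at_iff_der {α : Ordinal.{0}} {Γ : Sequent} : At α Γ ↔ ∃ β γ, Der α β γ Γ :=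
  ⟨fun ⟨β, h⟩ => ⟨β, h.der⟩, fun ⟨β, _, h⟩ => ⟨β, .of_der h⟩⟩

theorem derivable_iff_at {Γ : Sequent} : Derivable Γ ↔ ∃ α, At α Γ := by
  simp only [Derivable, at_iff_der]

theorem At.mono_rank {α α' : Ordinal.{0}} {Γ : Sequent} (h : At α Γ) (hα : α ≤ α') :
    At α' Γ := by
  obtain ⟨β, h⟩ := h
  exact ⟨β, h.mono_rank (Prod.Lex.toLex_mono ⟨hα, le_rfl⟩)⟩

/-- Weakening makes ranks cumulative. At a successor the rules for `L` therefore refer to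
derivability at one single rank. -/
theorem below_succ (α : Ordinal.{0}) : Below (Order.succ α) = At α := by
  funext Γ
  refine propext ⟨fun ⟨α₀, h, β, γ, hd⟩ => ?_, fun h => ?_⟩
  · exact (at_iff_der.2 ⟨β, γ, hd⟩).mono_rank (Order.lt_succ_iff.1 h)
  · exact ⟨α, Order.lt_succ α, at_iff_der.1 h⟩

/-- The properties of derivability that make provability of a code well defined and consistent. -/
structure Coherent (P : Sequent → Prop) : Prop where
  sim : ∀ {x y : CTT}, P {x} → Sim x y → P {y}
  consistent : ∀ S : Sent, P {S.code} → ¬ P {S.dual.code}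

theorem Deriv.consistent {r r' : Rank} (S : Sent) (h : Deriv r {S.code})
    (h' : Deriv r' {S.dual.code}) : False :=
  (Deriv.cut S ∅ (h.mono_rank (le_max_left r r')) (h'.mono_rank (le_max_right r r'))).not_empty rfl

theorem coherent_at (α : Ordinal.{0}) : Coherent (At α) where
  sim := fun ⟨β, h⟩ hs => ⟨β, h.sim_singleton hs⟩
  consistent := fun S ⟨_, h⟩ ⟨_, h'⟩ => h.consistent S h'

theorem coherent_derivable : Coherent Derivable where
  sim h hs := by
    obtain ⟨α, h⟩ := derivable_iff_at.1 h
    exact derivable_iff_at.2 ⟨α, (coherent_at α).sim h hs⟩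
  consistent S h h' := by
    obtain ⟨_, _, h⟩ := derivable_iff_at.1 h
    obtain ⟨_, _, h'⟩ := derivable_iff_at.1 h'
    exact h.consistent S h'

theorem Proves.mono {P Q : Sequent → Prop} (hPQ : ∀ Γ, P Γ → Q Γ) {x : CTT} (h : Proves P x) :
    Proves Q x := by
  obtain ⟨n, A, ρ, e, h⟩ := h
  exact ⟨n, A, ρ, e, hPQ _ h⟩

namespace Coherent

variable {P : Sequent → Prop} (hP : Coherent P) {n : ℕ} {ρ : Fin n → CTT}
include hP

/-- `Proves` allows any formula with the given code; by similarity of the normal forms the choice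
does not matter. -/
theorem proves_code {A : Fml False True n} :
    Proves P (A.code ρ) ↔ P {(A.nnf true).code ρ} := by
  refine ⟨fun ⟨m, B, ρ', e, h⟩ => ?_, fun h => ⟨n, A, ρ, rfl, h⟩⟩
  exact hP.sim h (Fml.sim_nnf B A e.symm true)

theorem proves_negD_code {A : Fml False True n} :
    Proves P (negD (A.code ρ)) ↔ P {(A.nnf false).code ρ} :=
  hP.proves_code (A := .neg A)

theorem not_proves_negD {x : CTT} (h : Proves P x) : ¬ Proves P (negD x) := by
  obtain ⟨n, A, ρ, rfl, h⟩ := h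
  rw [hP.proves_negD_code]
  have := hP.consistent ⟨A.nnf true, ρ⟩ h
  rwa [Sent.dual, Fml.dual_nnf] at this

theorem proves_lev {a b : CTT} : Proves P (lev a b) ↔ P {lev a b} :=
  hP.proves_code (A := .lev trivial (.var 0) (.var 1)) (ρ := ![a, b])

theorem proves_negD_lev {a b : CTT} : Proves P (negD (lev a b)) ↔ P {negD (lev a b)} :=
  hP.proves_negD_code (A := .lev trivial (.var 0) (.var 1)) (ρ := ![a, b])

end Coherent

/-! ## Universes -/

/-- A literal is not principal in a logical rule, and the logical axiom needs two distinct members.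
So below any weakenings only a literal axiom or a truth rule can have produced the sequent. -/
theorem Deriv.singleton_inv {r : Rank} {x : CTT} (h : Deriv r {x}) (hx : IsLitCode x) :
    (∃ α ≤ (ofLex r).1, Ax α x) ∨
    (∃ (n : ℕ) (A : Fml False True n) (ρ : Fin n → CTT), x = trD (A.code ρ) ∧
      ∃ r₀ ≤ r, Deriv r₀ {(A.nnf true).code ρ}) ∨
    (∃ (n : ℕ) (A : Fml False True n) (ρ : Fin n → CTT), x = negD (trD (A.code ρ)) ∧
      ∃ r₀ ≤ r, Deriv r₀ {(A.nnf false).code ρ}) := by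
  generalize hΓ : ({x} : Sequent) = Γ at h
  induction h with
  | ax y hy h =>
    subst hΓ
    rw [Finset.mem_singleton] at hy
    exact .inl ⟨_, le_rfl, hy ▸ h⟩
  | log b h h' =>
    subst hΓ
    rw [Finset.mem_singleton] at h h'
    cases (Head.trD b).unique (.negD _) (h.trans h'.symm)
  | conj S hS hk _ _ =>
    subst hΓ
    rw [Finset.mem_singleton] at hS
    exact ((Sent.kind_of_isLitCode (hS ▸ hx)).1 hk).elim
  | disj S i c hS hk _ _ =>
    subst hΓ
    rw [Finset.mem_singleton] at hS
    exact ((Sent.kind_of_isLitCode (hS ▸ hx)).2 hk).elim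
  | tr A ρ h hr hd _ =>
    subst hΓ
    rw [Finset.mem_singleton] at h
    exact .inr (.inl ⟨_, A, ρ, h.symm, _, hr.le, hd⟩)
  | ntr A ρ h hr hd _ =>
    subst hΓ
    rw [Finset.mem_singleton] at h
    exact .inr (.inr ⟨_, A, ρ, h.symm, _, hr.le, hd⟩)
  | weak hr _ ih =>
    rcases ih hΓ with ⟨α, hα, h⟩ | ⟨n, A, ρ, e, r₁, h₁, h⟩ | ⟨n, A, ρ, e, r₁, h₁, h⟩
    · exact .inl ⟨α, hα.trans (Prod.Lex.monotone_fst _ _ hr.le), h⟩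
    · exact .inr (.inl ⟨n, A, ρ, e, r₁, h₁.trans hr.le, h⟩)
    · exact .inr (.inr ⟨n, A, ρ, e, r₁, h₁.trans hr.le, h⟩)

theorem isLitCode_lev (a b : CTT) : IsLitCode (lev a b) := ⟨_, .pos (by simp) (.lev a b), by simp⟩

theorem isLitCode_negD_lev (a b : CTT) : IsLitCode (negD (lev a b)) :=
  ⟨_, .neg (.lev a b), by simp⟩

theorem At.ax_of_lev {α : Ordinal.{0}} {a b : CTT} (h : At α {lev a b}) :
    ∃ α₀ ≤ α, Ax α₀ (lev a b) := by
  obtain ⟨β, h⟩ := h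
  rcases h.singleton_inv (isLitCode_lev a b) with h | ⟨n, A, ρ, e, -⟩ | ⟨n, A, ρ, e, -⟩
  · exact h
  · cases (Head.lev a b).unique (.trD _) e
  · cases (Head.lev a b).unique (.negD _) e

theorem At.ax_of_negD_lev {α : Ordinal.{0}} {a b : CTT} (h : At α {negD (lev a b)}) :
    ∃ α₀ ≤ α, Ax α₀ (negD (lev a b)) := by
  obtain ⟨β, h⟩ := h
  rcases h.singleton_inv (isLitCode_negD_lev a b) with h | ⟨n, A, ρ, e, -⟩ | ⟨n, A, ρ, e, -⟩
  · exact h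
  · cases (Head.negD _).unique (.trD _) e
  · cases (Head.lev a b).unique (.trD _) (negD_inj.1 e)

theorem Ax.sideCond_of_lev {α : Ordinal.{0}} {a b : CTT} (h : Ax α (lev a b)) :
    SideCond α (Below α) a b := by
  generalize e : lev a b = x at h
  cases h with
  | univ a' b' hs _ => obtain ⟨rfl, rfl⟩ := lev_inj.1 e; exact hs
  | eq => cases Head.unique (.lev _ _) (.eqD _ _) e
  | nat => cases Head.unique (.lev _ _) (.natD _) e
  | _ => cases Head.unique (.lev _ _) (.negD _) e

theorem Ax.sideCond_of_negD_lev {α : Ordinal.{0}} {a b : CTT} (h : Ax α (negD (lev a b))) :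
    SideCond α (Below α) a b := by
  generalize e : negD (lev a b) = x at h
  cases h with
  | nuniv a' b' hs _ => obtain ⟨rfl, rfl⟩ := lev_inj.1 (negD_inj.1 e); exact hs
  | eq => cases Head.unique (.negD _) (.eqD _ _) e
  | nat => cases Head.unique (.negD _) (.natD _) e
  | univ => cases Head.unique (.negD _) (.lev _ _) e
  | ne => cases Head.unique (.lev _ _) (.eqD _ _) (negD_inj.1 e)
  | nnat => cases Head.unique (.lev _ _) (.natD _) (negD_inj.1 e)

theorem Ax.derivable {α : Ordinal.{0}} {x : CTT} (h : Ax α x) : Derivable {x} :=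
  derivable_iff_at.2 ⟨α, 0, h.deriv⟩

theorem proves_derivable_iff {x : CTT} : Proves Derivable x ↔ ∃ α, Proves (At α) x := by
  constructor
  · rintro ⟨n, A, ρ, e, h⟩
    obtain ⟨α, h⟩ := derivable_iff_at.1 h
    exact ⟨α, n, A, ρ, e, h⟩
  · rintro ⟨α, h⟩
    exact h.mono fun _ h => derivable_iff_at.2 ⟨α, h⟩

/-- There is only a set of closed terms, so the ranks deciding the instances `a c` have a supremum,
and ranks are cumulative. -/
theorem exists_isClassIn_at {a : CTT} (h : IsClassIn Derivable a) : ∃ α, IsClassIn (At α) a := by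
  have : ∀ c, ∃ α, Proves (At α) (app a c) ∨ Proves (At α) (negD (app a c)) := by
    intro c
    rcases h c with h | h
    · obtain ⟨α, h⟩ := proves_derivable_iff.1 h
      exact ⟨α, .inl h⟩
    · obtain ⟨α, h⟩ := proves_derivable_iff.1 h
      exact ⟨α, .inr h⟩
  choose g hg using this
  refine ⟨⨆ c, g c, fun c => ?_⟩
  have hle : g c ≤ ⨆ c, g c := Ordinal.le_iSup g c
  exact (hg c).imp (Proves.mono fun _ h => h.mono_rank hle) (Proves.mono fun _ h => h.mono_rank hle)

/-- The universe above a class `a` is truth at some `U`-rank at which `a` is a class. -/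
theorem exists_rank_of_isClassIn {a : CTT} (h : IsClassIn Derivable a) :
    ∃ α, IsClassIn (At α) a ∧ ∀ b, (Proves Derivable (lev a b) ↔ Proves (At α) b) ∧
      (Proves Derivable (negD (lev a b)) ↔ ¬ Proves (At α) b) := by
  have hex := exists_isClassIn_at h
  -- Minimality keeps all literals `L_a(b)` undecided up to `α`.
  let α := sInf {α | IsClassIn (At α) a}
  have hα : IsClassIn (At α) a := csInf_mem (s := {α | IsClassIn (At α) a}) hex
  have hmin : ∀ α' < α, ¬ IsClassIn (At α') a := fun α' h h' =>
    notMem_of_lt_csInf h (OrderBot.bddBelow _) h'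
  -- The side condition at `α' + 1 ≤ α` would make `a` a class already at `α' < α`.
  have hno : ∀ b α₀, α₀ ≤ α → ¬ SideCond α₀ (Below α₀) a b := by
    rintro b α₀ hle ⟨⟨α', rfl⟩, hc, -⟩
    rw [below_succ] at hc
    exact hmin α' (Order.succ_le_iff.1 hle) hc
  -- By inversion, a decision on `L_a(b)` up to `α` would come from an axiom at such a rank, whose
  -- side condition was just excluded.
  have hside : ∀ b, SideCond (Order.succ α) (Below (Order.succ α)) a b := by
    intro b
    rw [below_succ]
    refine ⟨⟨α, rfl⟩, hα, fun h => ?_, fun h => ?_⟩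
    · obtain ⟨α₀, hle, h⟩ := h.ax_of_lev
      exact hno b α₀ hle h.sideCond_of_lev
    · obtain ⟨α₀, hle, h⟩ := h.ax_of_negD_lev
      exact hno b α₀ hle h.sideCond_of_negD_lev
  have hpos : ∀ b, Proves (At α) b → Proves Derivable (lev a b) := fun b hb =>
    coherent_derivable.proves_lev.2 (Ax.derivable (.univ a b (hside b) (by rwa [below_succ])))
  have hneg : ∀ b, ¬ Proves (At α) b → Proves Derivable (negD (lev a b)) := fun b hb =>
    coherent_derivable.proves_negD_lev.2
      (Ax.derivable (.nuniv a b (hside b) (by rwa [below_succ])))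
  -- One of `L_a(b)` and `¬L_a(b)` has now been derived for every `b`; the converse directions
  -- follow from consistency across all ranks.
  refine ⟨α, hα, fun b => ⟨⟨fun h => ?_, hpos b⟩, fun h hb => ?_, hneg b⟩⟩
  · by_contra hb
    exact coherent_derivable.not_proves_negD h (hneg b hb)
  · exact coherent_derivable.not_proves_negD (hpos b hb) h

/-- The truth rule moves to the next `T`-rank at the same `U`-rank. Since `At α` leaves the `T`-rank
open, it is closed under the rule, and inversion gives the converse. -/
theorem Proves.trD_iff {α : Ordinal.{0}} {x : CTT} :
    Proves (At α) (trD x) ↔ Proves (At α) x := by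
  have ht : Proves (At α) (trD x) ↔ At α {trD x} :=
    (coherent_at α).proves_code (A := .tr (.var 0)) (ρ := ![x])
  rw [ht]
  constructor
  · rintro ⟨β, h⟩
    rcases h.singleton_inv (isLitCode_trD x) with ⟨α, _, h⟩ | ⟨n, A, ρ, e, r₀, hr, h⟩ |
      ⟨n, A, ρ, e, -⟩
    · obtain ⟨i, hi, h⟩ := h.signedHead
      rw [hi.unique (.pos (by simp) (.trD x)) rfl] at h
      simp at h
    · exact ⟨n, A, ρ, trD_inj.1 e, β, h.mono_rank hr⟩
    · cases (Head.trD x).unique (.negD _) e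
  · rintro ⟨n, A, ρ, rfl, β, h⟩
    exact ⟨Order.succ β, .tr A ρ (by simp) (Prod.Lex.right _ (Order.lt_succ β)) h⟩

theorem Proves.negD_trD_iff {α : Ordinal.{0}} {x : CTT} :
    Proves (At α) (negD (trD x)) ↔ Proves (At α) (negD x) := by
  have ht : Proves (At α) (negD (trD x)) ↔ At α {negD (trD x)} :=
    (coherent_at α).proves_negD_code (A := .tr (.var 0)) (ρ := ![x])
  rw [ht]
  constructor
  · rintro ⟨β, h⟩
    rcases h.singleton_inv (isLitCode_negD_trD x) with ⟨α, _, h⟩ | ⟨n, A, ρ, e, -⟩ |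
      ⟨n, A, ρ, e, r₀, hr, h⟩
    · obtain ⟨i, hi, h⟩ := h.signedHead
      rw [hi.unique (.neg (.trD x)) rfl] at h
      simp at h
    · cases (Head.negD _).unique (.trD _) e
    · rw [trD_inj.1 (negD_inj.1 e)]
      exact (coherent_at α).proves_negD_code.2 ⟨β, h.mono_rank hr⟩
  · rintro ⟨n, A, ρ, e, h⟩
    obtain ⟨B, rfl, rfl⟩ := Fml.code_eq_negD ρ e.symm
    obtain ⟨β, h⟩ := h
    exact ⟨Order.succ β, .ntr B ρ (by simp) (Prod.Lex.right _ (Order.lt_succ β)) h⟩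

/-! ## Soundness of the calculus -/

/-- Truth of a formula in negation normal form, with `T` and `L` read as derivability. -/
def NNF.Sat : {n : ℕ} → NNF n → (Fin n → CTT) → Prop
  | _, .eq s t, ρ => val ρ s = val ρ t
  | _, .ne s t, ρ => val ρ s ≠ val ρ t
  | _, .nat s, ρ => (val ρ s).IsNum
  | _, .nnat s, ρ => ¬ (val ρ s).IsNum
  | _, .tr s, ρ => Proves Derivable (val ρ s)
  | _, .ntr s, ρ => ¬ Proves Derivable (val ρ s)
  | _, .lev a b, ρ => Proves Derivable (CTT.lev (val ρ a) (val ρ b))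
  | _, .nlev a b, ρ => ¬ Proves Derivable (CTT.lev (val ρ a) (val ρ b))
  | _, .and A B, ρ => A.Sat ρ ∧ B.Sat ρ
  | _, .or A B, ρ => A.Sat ρ ∨ B.Sat ρ
  | _, .all A, ρ => ∀ c, A.Sat (Fin.cons c ρ)
  | _, .ex A, ρ => ∃ c, A.Sat (Fin.cons c ρ)

/-- Sequents contain codes only, so truth of a member has to be independent of the sentence chosen
to represent it. -/
theorem NNF.sat_of_code_eq {n m : ℕ} (F : NNF n) (F' : NNF m) {ρ : Fin n → CTT}
    {ρ' : Fin m → CTT} (h : F.code ρ = F'.code ρ') (hF : F.Sat ρ) : F'.Sat ρ' := by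
  induction F generalizing m with
  | eq s t =>
    have hh := ((NNF.eq s t).signedHead_code ρ).unique (F'.signedHead_code ρ') h
    cases F' <;> simp only [NNF.head, Prod.mk.injEq, reduceCtorEq, and_false, false_and] at hh
    obtain ⟨e, e'⟩ := eqD_inj.1 h
    simp only [Sat] at hF ⊢
    rwa [← e, ← e']
  | ne s t =>
    have hh := ((NNF.ne s t).signedHead_code ρ).unique (F'.signedHead_code ρ') h
    cases F' <;> simp only [NNF.head, Prod.mk.injEq, reduceCtorEq, and_false, false_and] at hh
    obtain ⟨e, e'⟩ := eqD_inj.1 (negD_inj.1 h)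
    simp only [Sat] at hF ⊢
    rwa [← e, ← e']
  | nat s =>
    have hh := ((NNF.nat s).signedHead_code ρ).unique (F'.signedHead_code ρ') h
    cases F' <;> simp only [NNF.head, Prod.mk.injEq, reduceCtorEq, and_false, false_and] at hh
    simp only [Sat] at hF ⊢
    rwa [← natD_inj.1 h]
  | nnat s =>
    have hh := ((NNF.nnat s).signedHead_code ρ).unique (F'.signedHead_code ρ') h
    cases F' <;> simp only [NNF.head, Prod.mk.injEq, reduceCtorEq, and_false, false_and] at hh
    simp only [Sat] at hF ⊢
    rwa [← natD_inj.1 (negD_inj.1 h)]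
  | tr s =>
    have hh := ((NNF.tr s).signedHead_code ρ).unique (F'.signedHead_code ρ') h
    cases F' <;> simp only [NNF.head, Prod.mk.injEq, reduceCtorEq, and_false, false_and] at hh
    simp only [Sat] at hF ⊢
    rwa [← trD_inj.1 h]
  | ntr s =>
    have hh := ((NNF.ntr s).signedHead_code ρ).unique (F'.signedHead_code ρ') h
    cases F' <;> simp only [NNF.head, Prod.mk.injEq, reduceCtorEq, and_false, false_and] at hh
    simp only [Sat] at hF ⊢
    rwa [← trD_inj.1 (negD_inj.1 h)]
  | lev a b =>
    have hh := ((NNF.lev a b).signedHead_code ρ).unique (F'.signedHead_code ρ') h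
    cases F' <;> simp only [NNF.head, Prod.mk.injEq, reduceCtorEq, and_false, false_and] at hh
    obtain ⟨e, e'⟩ := lev_inj.1 h
    simp only [Sat] at hF ⊢
    rwa [← e, ← e']
  | nlev a b =>
    have hh := ((NNF.nlev a b).signedHead_code ρ).unique (F'.signedHead_code ρ') h
    cases F' <;> simp only [NNF.head, Prod.mk.injEq, reduceCtorEq, and_false, false_and] at hh
    obtain ⟨e, e'⟩ := lev_inj.1 (negD_inj.1 h)
    simp only [Sat] at hF ⊢
    rwa [← e, ← e']
  | and A B ihA ihB =>
    have hh := ((NNF.and A B).signedHead_code ρ).unique (F'.signedHead_code ρ') h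
    cases F' <;> simp only [NNF.head, Prod.mk.injEq, reduceCtorEq, and_false, false_and] at hh
    have hs := (Sent.code_eq_code (S := ⟨.and A B, ρ⟩) (S' := ⟨.and _ _, ρ'⟩) h).2
    exact ⟨ihA _ (hs true (CTT.const .k)) hF.1, ihB _ (hs false (CTT.const .k)) hF.2⟩
  | or A B ihA ihB =>
    have hh := ((NNF.or A B).signedHead_code ρ).unique (F'.signedHead_code ρ') h
    cases F' <;> simp only [NNF.head, Prod.mk.injEq, reduceCtorEq, and_false, false_and] at hh
    have hs := (Sent.code_eq_code (S := ⟨.or A B, ρ⟩) (S' := ⟨.or _ _, ρ'⟩) h).2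
    exact hF.imp (ihA _ (hs true (CTT.const .k))) (ihB _ (hs false (CTT.const .k)))
  | all A ih =>
    have hh := ((NNF.all A).signedHead_code ρ).unique (F'.signedHead_code ρ') h
    cases F' <;> simp only [NNF.head, Prod.mk.injEq, reduceCtorEq, and_false, false_and] at hh
    have hs := (Sent.code_eq_code (S := ⟨.all A, ρ⟩) (S' := ⟨.all _, ρ'⟩) h).2
    exact fun c => ih _ (hs true c) (hF c)
  | ex A ih =>
    have hh := ((NNF.ex A).signedHead_code ρ).unique (F'.signedHead_code ρ') h
    cases F' <;> simp only [NNF.head, Prod.mk.injEq, reduceCtorEq, and_false, false_and] at hh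
    have hs := (Sent.code_eq_code (S := ⟨.ex A, ρ⟩) (S' := ⟨.ex _, ρ'⟩) h).2
    obtain ⟨c, hc⟩ := hF
    exact ⟨c, ih _ (hs true c) hc⟩

theorem Sent.sat_of_conj {S : Sent} (hk : S.kind = .conj)
    (h : ∀ i c, (S.sub i c).formula.Sat (S.sub i c).env) : S.formula.Sat S.env := by
  obtain ⟨F, ρ⟩ := S
  cases F <;> first
    | cases hk; done
    | exact ⟨h true (CTT.const .k), h false (CTT.const .k)⟩
    | exact fun c => h true c

theorem Sent.sat_of_disj {S : Sent} (hk : S.kind = .disj) (i : Bool) (c : CTT)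
    (h : (S.sub i c).formula.Sat (S.sub i c).env) : S.formula.Sat S.env := by
  obtain ⟨F, ρ⟩ := S
  cases F <;> first
    | cases hk; done
    | (cases i; exacts [.inr h, .inl h])
    | exact ⟨c, h⟩

/-- Every derivable sequent contains a true sentence. -/
theorem Deriv.sound {r : Rank} {Γ : Sequent} (h : Deriv r Γ) :
    ∃ S : Sent, S.code ∈ Γ ∧ S.formula.Sat S.env := by
  induction h with
  | ax x hx h =>
    have hd := h.derivable
    cases h with
    | eq b => exact ⟨⟨.eq (n := 1) (.var 0) (.var 0), ![b]⟩, hx, rfl⟩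
    | ne b c h => exact ⟨⟨.ne (n := 2) (.var 0) (.var 1), ![b, c]⟩, hx, h⟩
    | nat b h => exact ⟨⟨.nat (n := 1) (.var 0), ![b]⟩, hx, h⟩
    | nnat b h => exact ⟨⟨.nnat (n := 1) (.var 0), ![b]⟩, hx, h⟩
    | univ a b hs h =>
      -- With `L` read as derivability, the axiom is true because it is itself derivable; its
      -- negative counterpart is true by consistency.
      exact ⟨⟨.lev (n := 2) (.var 0) (.var 1), ![a, b]⟩, hx, coherent_derivable.proves_lev.2 hd⟩
    | nuniv a b hs h =>
      exact ⟨⟨.nlev (n := 2) (.var 0) (.var 1), ![a, b]⟩, hx, fun h =>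
        coherent_derivable.not_proves_negD h (coherent_derivable.proves_negD_lev.2 hd)⟩
  | log b h h' =>
    by_cases hb : Proves Derivable b
    · exact ⟨⟨.tr (n := 1) (.var 0), ![b]⟩, h, hb⟩
    · exact ⟨⟨.ntr (n := 1) (.var 0), ![b]⟩, h', hb⟩
  | @conj _ Γ S hS hk _ ih =>
    -- If no member of `Γ` is true, the true sentence of each premise must be the added subsentence;
    -- then all of these hold, and so does the principal formula.
    by_contra hno
    have hno : ∀ S' : Sent, S'.code ∈ Γ → ¬ S'.formula.Sat S'.env := fun S' h h' =>
      hno ⟨S', h, h'⟩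
    refine hno S hS (Sent.sat_of_conj hk fun i c => ?_)
    obtain ⟨S', hS', h⟩ := ih i c
    rcases Finset.mem_insert.1 hS' with e | hS'
    · exact NNF.sat_of_code_eq _ _ e h
    · exact (hno S' hS' h).elim
  | disj S i c hS hk _ ih =>
    obtain ⟨S', hS', h⟩ := ih
    rcases Finset.mem_insert.1 hS' with e | hS'
    · exact ⟨S, hS, Sent.sat_of_disj hk i c (NNF.sat_of_code_eq _ _ e h)⟩
    · exact ⟨S', hS', h⟩
  | tr A ρ h hr hd _ =>
    exact ⟨⟨.tr (n := 1) (.var 0), ![A.code ρ]⟩, h, coherent_derivable.proves_code.2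
      (derivable_iff_at.2 ⟨_, _, hd⟩)⟩
  | ntr A ρ h hr hd _ =>
    exact ⟨⟨.ntr (n := 1) (.var 0), ![A.code ρ]⟩, h, fun h => coherent_derivable.not_proves_negD h
      (coherent_derivable.proves_negD_code.2 (derivable_iff_at.2 ⟨_, _, hd⟩))⟩
  | weak _ _ ih => exact ih

theorem At.sound {α : Ordinal.{0}} {n : ℕ} {F : NNF n} {ρ : Fin n → CTT}
    (h : At α {F.code ρ}) : F.Sat ρ := by
  obtain ⟨β, h⟩ := h
  obtain ⟨S, hS, h⟩ := h.sound
  exact NNF.sat_of_code_eq _ _ (Finset.mem_singleton.1 hS) h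

/-! ## Formulas without `L` -/

namespace Fml

variable {n : ℕ}

/-- A formula without `U` and `L`, read as a formula that may contain `L`. -/
def lift {n : ℕ} : Fml False False n → Fml False True n
  | eq s t => eq s t
  | nat s => nat s
  | tr s => tr s
  | univ h _ => h.elim
  | lev h _ _ => h.elim
  | neg A => neg A.lift
  | and A B => and A.lift B.lift
  | imp A B => imp A.lift B.lift
  | all A => all A.lift

theorem dot_lift (A : Fml False False n) : A.lift.dot = A.dot := by
  induction A with
  | univ h => exact h.elim
  | lev h => exact h.elim
  | _ => simp_all [lift, dot]

theorem nnf_lift (A : Fml False False n) (i : Bool) : A.lift.nnf i = A.nnf i := by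
  induction A generalizing i with
  | univ h => exact h.elim
  | lev h => exact h.elim
  | neg A ih => cases i <;> exact ih _
  | _ => cases i <;> simp_all [lift, nnf]

theorem sat_nnf (A : Fml False False n) (ρ : Fin n → CTT) (i : Bool) :
    (A.nnf i).Sat ρ ↔ cond i (modelVFU.Sat ρ A.toFS) (¬ modelVFU.Sat ρ A.toFS) := by
  have ev : ∀ {n : ℕ} (ρ : Fin n → CTT) (t : Tm n), modelVFU.eval ρ t = val ρ t := by
    intro n ρ t
    induction t with
    | var i => rfl
    | const c => rfl
    | app f a ihf iha =>
      simp only [FSStructure.eval, val, ihf, iha]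
      rfl
  induction A generalizing i with
  | univ h => exact h.elim
  | lev h => exact h.elim
  | eq s t => cases i <;> simp [nnf, NNF.Sat, toFS, FSStructure.Sat, ev] <;> rfl
  | nat s => cases i <;> simp [nnf, NNF.Sat, toFS, FSStructure.Sat, ev] <;> rfl
  | tr s => cases i <;> simp [nnf, NNF.Sat, toFS, FSStructure.Sat, ev] <;> rfl
  | neg A ih => cases i <;> simp [nnf, toFS, FSStructure.Sat, ih]
  | and A B ihA ihB =>
    cases i <;> simp [nnf, NNF.Sat, toFS, FSStructure.Sat, ihA, ihB]
    tauto
  | imp A B ihA ihB =>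
    cases i <;> simp [nnf, NNF.Sat, toFS, FSStructure.Sat, ihA, ihB]
    tauto
  | all A ih =>
    cases i
    · simp only [nnf, NNF.Sat, toFS, FSStructure.Sat, ih, cond_false, not_forall]; rfl
    · simp only [nnf, NNF.Sat, toFS, FSStructure.Sat, ih, cond_true]; rfl

/-- Substitution in a formula is similar to a change of the assignment. -/
theorem sim_nnf_subst {m : ℕ} (A : Fml False False n) (σ : Fin n → Tm m) (ρ : Fin m → CTT)
    (i : Bool) :
    Sim (((A.subst σ).nnf i).code ρ) ((A.nnf i).code fun j => val ρ (σ j)) := by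
  induction A generalizing m i with
  | univ h => exact h.elim
  | lev h => exact h.elim
  | eq s t =>
    cases i <;> exact .of_eq (by simp only [subst, nnf, NNF.code_eq, NNF.code_ne, val_subst])
  | nat s =>
    cases i <;> exact .of_eq (by simp only [subst, nnf, NNF.code_nat, NNF.code_nnat, val_subst])
  | tr s =>
    cases i <;> exact .of_eq (by simp only [subst, nnf, NNF.code_tr, NNF.code_ntr, val_subst])
  | neg A ih => cases i <;> exact ih _ _ _
  | and A B ihA ihB => cases i; exacts [.or (ihA _ _ _) (ihB _ _ _), .and (ihA _ _ _) (ihB _ _ _)]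
  | imp A B ihA ihB => cases i; exacts [.and (ihA _ _ _) (ihB _ _ _), .or (ihA _ _ _) (ihB _ _ _)]
  | all A ih =>
    have key : ∀ c, (fun j => val (Fin.cons c ρ : Fin (m + 1) → CTT)
        ((Fin.cons (Tm.var 0) fun i => (σ i).weaken : Fin _ → Tm (m + 1)) j)) =
        Fin.cons c fun j => val ρ (σ j) := by
      intro c
      funext j
      refine Fin.cases rfl (fun j => ?_) j
      simp only [Fin.cons_succ, Tm.weaken, val_subst, val]
    cases i
    · exact .ex fun c => key c ▸ ih _ _ false
    · exact .all fun c => key c ▸ ih _ _ true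

end Fml

/-- Formulas without `L`. -/
def NNF.LFree {n : ℕ} : NNF n → Prop
  | lev _ _ => False
  | nlev _ _ => False
  | and A B => A.LFree ∧ B.LFree
  | or A B => A.LFree ∧ B.LFree
  | all A => A.LFree
  | ex A => A.LFree
  | _ => True

theorem Fml.lFree_nnf {n : ℕ} (A : Fml False False n) (i : Bool) : (A.nnf i).LFree := by
  induction A generalizing i with
  | univ h => exact h.elim
  | lev h => exact h.elim
  | neg A ih => cases i <;> exact ih _
  | _ => cases i <;> simp_all [nnf, NNF.LFree]

/-! ### Derived rules, excluded middle and theorems of classical logic -/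

namespace Deriv

variable {r : Rank} {n : ℕ} {ρ : Fin n → CTT} {Γ : Sequent}

theorem and_mem (A B : NNF n) (h : (NNF.and A B).code ρ ∈ Γ)
    (hA : Deriv r (insert (A.code ρ) Γ)) (hB : Deriv r (insert (B.code ρ) Γ)) : Deriv r Γ :=
  .conj ⟨.and A B, ρ⟩ h rfl fun i _ => by cases i; exacts [hB, hA]

theorem or_mem (A B : NNF n) (h : (NNF.or A B).code ρ ∈ Γ)
    (hAB : Deriv r (insert (A.code ρ) (insert (B.code ρ) Γ))) : Deriv r Γ :=
  -- Principal formulas are kept, so the rule can be used twice to add both disjuncts. The constant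
  -- is a dummy: the instance term is ignored for `∨`.
  .disj ⟨.or A B, ρ⟩ false (CTT.const .k) h rfl <|
    .disj ⟨.or A B, ρ⟩ true (CTT.const .k) (Finset.mem_insert_of_mem h) rfl hAB

theorem all_mem (A : NNF (n + 1)) (h : (NNF.all A).code ρ ∈ Γ)
    (hA : ∀ c, Deriv r (insert (A.code (Fin.cons c ρ)) Γ)) : Deriv r Γ :=
  .conj ⟨.all A, ρ⟩ h rfl fun _ c => hA c

theorem ex_mem (A : NNF (n + 1)) (c : CTT) (h : (NNF.ex A).code ρ ∈ Γ)
    (hA : Deriv r (insert (A.code (Fin.cons c ρ)) Γ)) : Deriv r Γ :=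
  .disj ⟨.ex A, ρ⟩ true c h rfl hA

/-- The logical axiom covers `T`, and truth in the term model decides `=` and `N`. There is no such
axiom for `L`, whence the restriction to `L`-free formulas. -/
theorem identity_nnf (F : NNF n) (hF : F.LFree) (h : F.code ρ ∈ Γ) (h' : F.dual.code ρ ∈ Γ) :
    Deriv r Γ := by
  induction F generalizing Γ with
  | eq s t =>
    by_cases e : val ρ s = val ρ t
    · exact .ax _ h (by rw [NNF.code_eq, e]; exact .eq _)
    · exact .ax _ h' (.ne _ _ e)
  | ne s t =>
    by_cases e : val ρ s = val ρ t
    · exact .ax _ h' (by rw [NNF.dual, NNF.code_eq, e]; exact .eq _)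
    · exact .ax _ h (.ne _ _ e)
  | nat s =>
    by_cases e : (val ρ s).IsNum
    · exact .ax _ h (.nat _ e)
    · exact .ax _ h' (.nnat _ e)
  | nnat s =>
    by_cases e : (val ρ s).IsNum
    · exact .ax _ h' (.nat _ e)
    · exact .ax _ h (.nnat _ e)
  | tr s => exact .log _ h h'
  | ntr s => exact .log _ h' h
  | lev a b => exact hF.elim
  | nlev a b => exact hF.elim
  | and A B ihA ihB =>
    refine or_mem _ _ h' (and_mem A B (ρ := ρ) (by simp [h]) ?_ ?_)
    · exact ihA (ρ := ρ) hF.1 (by simp) (by simp)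
    · exact ihB (ρ := ρ) hF.2 (by simp) (by simp)
  | or A B ihA ihB =>
    refine or_mem _ _ h (and_mem A.dual B.dual (ρ := ρ)
      (Finset.mem_insert_of_mem (Finset.mem_insert_of_mem h')) ?_ ?_)
    · exact ihA (ρ := ρ) hF.1 (by simp) (by simp)
    · exact ihB (ρ := ρ) hF.2 (by simp) (by simp)
  | all A ih =>
    exact all_mem A h fun c => ex_mem A.dual c (ρ := ρ) (Finset.mem_insert_of_mem h')
      (ih (ρ := Fin.cons c ρ) hF (by simp) (by simp))
  | ex A ih =>
    exact all_mem A.dual h' fun c => ex_mem A c (ρ := ρ) (Finset.mem_insert_of_mem h)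
      (ih (ρ := Fin.cons c ρ) hF (by simp) (by simp))

/-- The law of excluded middle for formulas without `L`. -/
theorem identity (A : Fml False False n) (i : Bool) (ρ : Fin n → CTT)
    (h : (A.nnf i).code ρ ∈ Γ) (h' : (A.nnf !i).code ρ ∈ Γ) : Deriv r Γ :=
  identity_nnf (A.nnf i) (A.lFree_nnf i) h (by rwa [Fml.dual_nnf])

/-- The law of excluded middle up to similarity. -/
theorem identity_sim (A : Fml False False n) (i : Bool) (ρ : Fin n → CTT) {x y : CTT}
    (hx : x ∈ Γ) (hy : y ∈ Γ) (hxA : Sim x ((A.nnf i).code ρ))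
    (hyA : Sim y ((A.nnf !i).code ρ)) : Deriv r Γ := by
  refine (identity (r := r) (Γ := {(A.nnf i).code ρ, (A.nnf !i).code ρ}) A i ρ
    (by simp) (by simp)).sim fun z hz => ?_
  rcases Finset.mem_insert.1 hz with rfl | hz
  · exact ⟨x, hx, hxA.symm⟩
  · rw [Finset.mem_singleton.1 hz]
    exact ⟨y, hy, hyA.symm⟩

end Deriv

namespace At

variable {α : Ordinal.{0}} {n : ℕ} {ρ : Fin n → CTT}

/-- Two cuts, on `A` and on `A → B`, reduce this to excluded middle for `A` and `B`. -/
theorem modus_ponens (A B : Fml False False n) (h : At α {((Fml.imp A B).nnf true).code ρ})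
    (hA : At α {(A.nnf true).code ρ}) : At α {(B.nnf true).code ρ} := by
  obtain ⟨β, h⟩ := h
  obtain ⟨β', hA⟩ := hA
  refine ⟨max β β', ?_⟩
  have hle : toLex (α, β) ≤ toLex (α, max β β') := Prod.Lex.toLex_mono ⟨le_rfl, le_max_left _ _⟩
  have hle' : toLex (α, β') ≤ toLex (α, max β β') :=
    Prod.Lex.toLex_mono ⟨le_rfl, le_max_right _ _⟩
  refine Deriv.cut ⟨A.nnf true, ρ⟩ _ ((hA.mono_rank hle').mono (by simp [Sent.code])) ?_
  refine Deriv.cut ⟨(Fml.imp A B).nnf true, ρ⟩ _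
    ((h.mono_rank hle).mono (by simp [Sent.code])) ?_
  simp only [Sent.dual, Fml.dual_nnf, Sent.code, Bool.not_true]
  refine Deriv.and_mem (A.nnf true) (B.nnf false) (ρ := ρ) (Finset.mem_insert_self _ _) ?_ ?_
  · exact Deriv.identity A true ρ (Finset.mem_insert_self _ _) (by simp)
  · exact Deriv.identity B false ρ (Finset.mem_insert_self _ _) (by simp)

theorem generalization (A : Fml False False (n + 1))
    (h : ∀ c, At α {(A.nnf true).code (Fin.cons c ρ)}) :
    At α {((Fml.all A).nnf true).code ρ} := by
  choose g hg using h
  -- The instances may have different `T`-ranks; their supremum serves all of them without changing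
  -- the `U`-rank.
  refine ⟨⨆ c, g c, Deriv.all_mem (A.nnf true) (Finset.mem_singleton_self _) fun c => ?_⟩
  have hle : toLex (α, g c) ≤ toLex (α, ⨆ c, g c) :=
    Prod.Lex.toLex_mono ⟨le_rfl, Ordinal.le_iSup g c⟩
  exact ((hg c).mono_rank hle).mono (Finset.singleton_subset_iff.2 (Finset.mem_insert_self _ _))

theorem of_literal {A : Fml False False n} (hA : IsLit A) (h : modelVFU.Sat ρ A.toFS) :
    At α {(A.nnf true).code ρ} := by
  have h := (A.sat_nnf ρ true).2 h
  cases hA with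
  | eq s t =>
    have h : val ρ s = val ρ t := h
    exact ⟨0, .ax _ (Finset.mem_singleton_self _) (by rw [Fml.nnf, NNF.code_eq, h]; exact .eq _)⟩
  | ne s t => exact ⟨0, .ax _ (Finset.mem_singleton_self _) (.ne _ _ h)⟩
  | nat s => exact ⟨0, .ax _ (Finset.mem_singleton_self _) (.nat _ h)⟩
  | nnat s => exact ⟨0, .ax _ (Finset.mem_singleton_self _) (.nnat _ h)⟩

end At

theorem Fml.sim_nnf_inst {n : ℕ} (A : Fml False False (n + 1)) (t : Tm n) (ρ : Fin n → CTT)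
    (i : Bool) : Sim (((A.inst t).nnf i).code ρ) ((A.nnf i).code (Fin.cons (val ρ t) ρ)) := by
  have h := A.sim_nnf_subst (Fin.cons t Tm.var) ρ i
  have e : (fun j => val ρ ((Fin.cons t Tm.var : Fin (n + 1) → Tm n) j)) =
      Fin.cons (val ρ t) ρ := by
    funext j
    refine Fin.cases rfl (fun j => rfl) j
  rwa [e] at h

theorem Fml.sim_nnf_weaken {n : ℕ} (A : Fml False False n) (c : CTT) (ρ : Fin n → CTT)
    (i : Bool) : Sim ((A.weaken.nnf i).code (Fin.cons c ρ)) ((A.nnf i).code ρ) :=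
  A.sim_nnf_subst (fun i => Tm.var i.succ) (Fin.cons c ρ) i

/-- Modus ponens is handled by cut and generalization by the infinitary rule. Implications among the
axioms are decomposed until a complementary pair or a true literal appears, using similarity where
substitution changes codes. -/
theorem At.of_logThm {n : ℕ} {C : Fml False False n} (h : LogThm C) (α : Ordinal.{0})
    (ρ : Fin n → CTT) : At α {(C.nnf true).code ρ} := by
  have start : ∀ {n : ℕ} {ρ : Fin n → CTT} (A B : NNF n),
      Deriv (toLex (α, 0)) {A.code ρ, B.code ρ, (NNF.or A B).code ρ} →
      At α {(NNF.or A B).code ρ} := fun A B h =>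
    ⟨0, .or_mem A B (Finset.mem_singleton_self _) h⟩
  induction h with
  | mp _ _ ih ih' => exact At.modus_ponens _ _ (ih ρ) (ih' ρ)
  | gen _ ih => exact At.generalization _ fun c => ih _
  | ax_k A B =>
    refine start (A.nnf false) (.or (B.nnf false) (A.nnf true)) ?_
    refine .or_mem (B.nnf false) (A.nnf true) (ρ := ρ) (by simp) ?_
    exact .identity A true ρ (by simp) (by simp)
  | ax_s A B C =>
    refine start (.and (A.nnf true) (.and (B.nnf true) (C.nnf false)))
      (.or (.and (A.nnf true) (B.nnf false)) (.or (A.nnf false) (C.nnf true))) ?_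
    refine .or_mem (.and (A.nnf true) (B.nnf false)) (.or (A.nnf false) (C.nnf true)) (ρ := ρ)
      (by simp) ?_
    refine .or_mem (A.nnf false) (C.nnf true) (ρ := ρ) (by simp) ?_
    refine .and_mem (A.nnf true) (.and (B.nnf true) (C.nnf false)) (ρ := ρ) (by simp)
      (.identity A true ρ (by simp) (by simp)) ?_
    refine .and_mem (B.nnf true) (C.nnf false) (ρ := ρ) (by simp) ?_
      (.identity C false ρ (by simp) (by simp))
    exact .and_mem (A.nnf true) (B.nnf false) (ρ := ρ) (by simp)
      (.identity A true ρ (by simp) (by simp)) (.identity B false ρ (by simp) (by simp))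
  | ax_contra A B =>
    refine start (.and (A.nnf false) (B.nnf true)) (.or (B.nnf false) (A.nnf true)) ?_
    refine .or_mem (B.nnf false) (A.nnf true) (ρ := ρ) (by simp) ?_
    exact .and_mem (A.nnf false) (B.nnf true) (ρ := ρ) (by simp)
      (.identity A false ρ (by simp) (by simp)) (.identity B true ρ (by simp) (by simp))
  | ax_and_left A B =>
    refine start (.or (A.nnf false) (B.nnf false)) (A.nnf true) ?_
    exact .or_mem (A.nnf false) (B.nnf false) (ρ := ρ) (by simp)
      (.identity A true ρ (by simp) (by simp))
  | ax_and_right A B =>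
    refine start (.or (A.nnf false) (B.nnf false)) (B.nnf true) ?_
    exact .or_mem (A.nnf false) (B.nnf false) (ρ := ρ) (by simp)
      (.identity B true ρ (by simp) (by simp))
  | ax_and_intro A B =>
    refine start (A.nnf false) (.or (B.nnf false) (.and (A.nnf true) (B.nnf true))) ?_
    refine .or_mem (B.nnf false) (.and (A.nnf true) (B.nnf true)) (ρ := ρ) (by simp) ?_
    exact .and_mem (A.nnf true) (B.nnf true) (ρ := ρ) (by simp)
      (.identity A true ρ (by simp) (by simp)) (.identity B true ρ (by simp) (by simp))
  | ax_inst A t =>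
    refine start (.ex (A.nnf false)) ((A.inst t).nnf true) ?_
    refine .ex_mem (A.nnf false) (val ρ t) (ρ := ρ) (by simp) ?_
    exact .identity_sim A false (Fin.cons (val ρ t) ρ)
      (x := (A.nnf false).code (Fin.cons (val ρ t) ρ)) (y := ((A.inst t).nnf true).code ρ)
      (by simp) (by simp) (.refl _) (A.sim_nnf_inst t ρ true)
  | ax_all A B =>
    refine start (.ex (.and (A.weaken.nnf true) (B.nnf false)))
      (.or (A.nnf false) (.all (B.nnf true))) ?_
    refine .or_mem (A.nnf false) (.all (B.nnf true)) (ρ := ρ) (by simp) ?_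
    refine .all_mem (B.nnf true) (ρ := ρ) (by simp) fun c => ?_
    refine .ex_mem (.and (A.weaken.nnf true) (B.nnf false)) c (ρ := ρ) (by simp) ?_
    refine .and_mem (A.weaken.nnf true) (B.nnf false) (ρ := Fin.cons c ρ) (by simp) ?_
      (.identity B false (Fin.cons c ρ) (by simp) (by simp))
    exact .identity_sim A true ρ (x := (A.weaken.nnf true).code (Fin.cons c ρ))
      (y := (A.nnf false).code ρ) (by simp) (by simp) (A.sim_nnf_weaken c ρ true) (.refl _)
  | ax_refl t => exact ⟨0, .ax _ (Finset.mem_singleton_self _) (.eq _)⟩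
  | ax_leibniz A s t =>
    refine start (.ne s t) (.or ((A.inst s).nnf false) ((A.inst t).nnf true)) ?_
    -- If the values differ, the premise `s ≠ t` in the sequent is a true literal; if they agree,
    -- both instances of `A` are similar to the same one.
    by_cases e : val ρ s = val ρ t
    · refine .or_mem ((A.inst s).nnf false) ((A.inst t).nnf true) (ρ := ρ) (by simp) ?_
      refine .identity_sim A false (Fin.cons (val ρ s) ρ) (x := ((A.inst s).nnf false).code ρ)
        (y := ((A.inst t).nnf true).code ρ) (by simp) (by simp) (A.sim_nnf_inst s ρ false) ?_
      rw [e]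
      exact A.sim_nnf_inst t ρ true
    · exact .ax _ (Finset.mem_insert_self _ _) (.ne _ _ e)

/-! ## The model -/

namespace FSStructure

variable (M : FSStructure)

theorem eval_subst {n m : ℕ} (σ : Fin n → Tm m) (ρ : Fin m → M.carrier) (t : Tm n) :
    M.eval ρ (t.subst σ) = M.eval (fun i => M.eval ρ (σ i)) t := by
  induction t with
  | var i => rfl
  | const c => rfl
  | app f a ihf iha => simp only [Tm.subst, eval, ihf, iha]

theorem eval_weaken {n : ℕ} (ρ : Fin n → M.carrier) (d : M.carrier) (t : Tm n) :
    M.eval (Fin.cons d ρ) t.weaken = M.eval ρ t := by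
  rw [Tm.weaken, eval_subst]
  rfl

theorem sat_subst {n m : ℕ} (A : FS n) (σ : Fin n → Tm m) (ρ : Fin m → M.carrier) :
    M.Sat ρ (A.subst σ) ↔ M.Sat (fun i => M.eval ρ (σ i)) A := by
  induction A generalizing m with
  | lev h => exact h.elim
  | all A ih =>
    refine forall_congr' fun d => ?_
    rw [ih]
    have : (fun i => M.eval (Fin.cons d ρ : Fin (m + 1) → M.carrier)
        ((Fin.cons (Tm.var 0) fun i => (σ i).weaken : Fin _ → Tm (m + 1)) i)) =
        Fin.cons d fun i => M.eval ρ (σ i) := by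
      funext i
      refine Fin.cases rfl (fun i => ?_) i
      simp only [Fin.cons_succ, eval_weaken]
    rw [this]
  | _ => simp_all only [Fml.subst, Sat, eval_subst]

theorem sat_close {n : ℕ} (A : FS n) : M.Sat Fin.elim0 A.close ↔ ∀ ρ, M.Sat ρ A := by
  induction n with
  | zero =>
    exact ⟨fun h ρ => by rwa [Subsingleton.elim ρ Fin.elim0], fun h => h _⟩
  | succ n ih =>
    rw [Fml.close, ih]
    refine ⟨fun h ρ => ?_, fun h ρ d => h _⟩
    rw [← Fin.cons_self_tail ρ]
    exact h (Fin.tail ρ) (ρ 0)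

theorem sat_or {n : ℕ} (A B : FS n) (ρ : Fin n → M.carrier) :
    M.Sat ρ (A.or B) ↔ M.Sat ρ A ∨ M.Sat ρ B := by
  simp only [Fml.or, Sat]
  tauto

theorem sat_isClass {n : ℕ} (f : Tm n) (ρ : Fin n → M.carrier) :
    M.Sat ρ (isClass f) ↔ ∀ d, M.T (M.app (M.eval ρ f) d) ∨
      M.T (M.app (M.const .negD) (M.app (M.eval ρ f) d)) := by
  refine forall_congr' fun d => ?_
  rw [sat_or]
  simp only [Sat, Tm.negD, eval, eval_weaken]
  rfl

end FSStructure

theorem modelVFU_eval {n : ℕ} (ρ : Fin n → CTT) (t : Tm n) : modelVFU.eval ρ t = val ρ t := by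
  induction t with
  | var i => rfl
  | const c => rfl
  | app f a ihf iha =>
    simp only [FSStructure.eval, val, ihf, iha]
    rfl

theorem proves_code_iff {P : Sequent → Prop} (hP : Coherent P) {n : ℕ} (A : Fml False False n)
    (ρ : Fin n → CTT) : Proves P (val ρ A.dot) ↔ P {(A.nnf true).code ρ} := by
  rw [← A.dot_lift, ← A.nnf_lift]
  exact hP.proves_code

theorem isNum_zero : IsNum (CTT.const .zero) := ⟨0, rfl⟩

theorem IsNum.succ {x : CTT} (h : x.IsNum) : IsNum (app (CTT.const .sN) x) := by
  obtain ⟨m, rfl⟩ := h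
  exact ⟨m + 1, rfl⟩

theorem modelVFU_sat_ton {n : ℕ} {A : FS n} (h : TONAx A) (ρ : Fin n → CTT) :
    modelVFU.Sat ρ A := by
  cases h with
  | k => exact app_k _ _
  | s => exact app_s _ _ _
  | pair =>
    obtain ⟨a, ha⟩ := Quot.exists_rep (ρ 0)
    obtain ⟨b, hb⟩ := Quot.exists_rep (ρ 1)
    constructor
    · change app (CTT.const .p0) (app (app (CTT.const .p) (ρ 0)) (ρ 1)) = ρ 0
      rw [← ha, ← hb]
      exact Quot.sound (.p0 a b)
    · change app (CTT.const .p1) (app (app (CTT.const .p) (ρ 0)) (ρ 1)) = ρ 1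
      rw [← ha, ← hb]
      exact Quot.sound (.p1 a b)
  | nat => exact ⟨isNum_zero, fun d hd => IsNum.succ hd⟩
  | succ =>
    rintro _ ⟨m, rfl⟩
    -- The only axiom of the applicative theory that uses confluence; the others follow from the
    -- conversions and the form of the numerals.
    have h : app (CTT.const .sN) (Quot.mk Red (Tm.numeral m)) ≠ CTT.const .zero :=
      (const_ne_app_const (by trivial) _).symm
    exact ⟨h, Quot.sound (.pN m)⟩
  | pred =>
    rintro _ ⟨⟨m, rfl⟩, h⟩
    cases m with
    | zero => exact (h rfl).elim
    | succ m =>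
      have e : app (CTT.const .pN) (Quot.mk Red (Tm.numeral (m + 1))) =
          Quot.mk Red (Tm.numeral m) := Quot.sound (.pN m)
      exact ⟨⟨m, e⟩, congrArg (app (CTT.const .sN)) e⟩
  | cases_eq =>
    rintro ⟨⟨m, hm⟩, -, h⟩
    obtain ⟨a, ha⟩ := Quot.exists_rep (ρ 0)
    obtain ⟨b, hb⟩ := Quot.exists_rep (ρ 1)
    change ρ 2 = _ at hm
    change ρ 2 = ρ 3 at h
    change app (app (app (app (CTT.const .dN) (ρ 0)) (ρ 1)) (ρ 2)) (ρ 3) = ρ 0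
    rw [← h, hm, ← ha, ← hb]
    exact Quot.sound (.dN_eq a b m)
  | cases_ne =>
    rintro ⟨⟨m, hm⟩, ⟨m', hm'⟩, h⟩
    obtain ⟨a, ha⟩ := Quot.exists_rep (ρ 0)
    obtain ⟨b, hb⟩ := Quot.exists_rep (ρ 1)
    change ρ 2 = _ at hm
    change ρ 3 = _ at hm'
    change ρ 2 ≠ ρ 3 at h
    change app (app (app (app (CTT.const .dN) (ρ 0)) (ρ 1)) (ρ 2)) (ρ 3) = ρ 1
    rw [hm, hm'] at h ⊢
    rw [← ha, ← hb]
    exact Quot.sound (.dN_ne a b m m' fun e => h (by rw [e]))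
  | ind A =>
    rintro ⟨h₀, hs⟩ _ ⟨m, rfl⟩
    induction m with
    | zero =>
      have h₀ := (modelVFU.sat_subst A _ ρ).1 h₀
      convert h₀ using 1
      funext i
      exact Fin.cases rfl (fun i => rfl) i
    | succ m ih =>
      have h := (modelVFU.sat_subst A _ _).1 (hs _ ⟨⟨m, rfl⟩, ih⟩)
      convert h using 1
      funext i
      exact Fin.cases rfl (fun i => rfl) i

/-- A universe is truth at some `U`-rank. -/
theorem exists_rank_of_univ {x : CTT} (h : modelVFU.U x) :
    ∃ α, ∀ b, (Proves Derivable (app x b) ↔ Proves (At α) b) ∧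
      (Proves Derivable (negD (app x b)) ↔ ¬ Proves (At α) b) := by
  obtain ⟨a, rfl, ha⟩ := h
  obtain ⟨α, -, h⟩ := exists_rank_of_isClassIn ha
  exact ⟨α, h⟩

theorem exists_rank_of_sat_univ {n : ℕ} {ρ : Fin n → CTT} {u : Fin n}
    (h : modelVFU.Sat ρ (.univ trivial (v u))) :
    ∃ α, (∀ A : Fml False False n, modelVFU.Sat ρ (.tr (v u ⬝ A.dot)) ↔
        At α {(A.nnf true).code ρ}) ∧
      ∀ b, (Proves Derivable (app (ρ u) b) ↔ Proves (At α) b) ∧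
        (Proves Derivable (negD (app (ρ u) b)) ↔ ¬ Proves (At α) b) := by
  obtain ⟨α, h⟩ := exists_rank_of_univ (x := ρ u) h
  refine ⟨α, fun A => ?_, h⟩
  rw [← proves_code_iff (coherent_at α), ← (h _).1, ← modelVFU_eval]
  rfl

theorem modelVFU_sat {n : ℕ} {A : FS n} (h : VFUAx A) (ρ : Fin n → CTT) :
    modelVFU.Sat ρ A := by
  cases h with
  | ton h => exact modelVFU_sat_ton h ρ
  | u_out u A =>
    intro hu ht
    obtain ⟨α, h, -⟩ := exists_rank_of_sat_univ hu
    exact (A.sat_nnf ρ true).1 ((h A).1 ht).sound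
  | u_elem u P hP =>
    intro hu hs
    obtain ⟨α, h, -⟩ := exists_rank_of_sat_univ hu
    exact (h P).2 (At.of_literal hP hs)
  | u_imp u A B =>
    intro hu hAB hA
    obtain ⟨α, h, -⟩ := exists_rank_of_sat_univ hu
    exact (h B).2 (At.modus_ponens A B ((h _).1 hAB) ((h A).1 hA))
  | u_univ u A =>
    intro hu hA
    obtain ⟨α, h, h'⟩ := exists_rank_of_sat_univ hu
    -- The value of `u` does not depend on the quantified variable, so all instances are provable at
    -- the same rank `α`.
    refine (h (.all A)).2 (At.generalization A fun c => ?_)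
    rw [← proves_code_iff (coherent_at α), ← (h' _).1, ← modelVFU_eval]
    exact hA c
  | u_log u C hC =>
    intro hu
    obtain ⟨α, h, -⟩ := exists_rank_of_sat_univ hu
    exact (h C).2 (At.of_logThm hC α ρ)
  | u_cons =>
    rintro hu x ⟨h₁, h₂⟩
    obtain ⟨α, -, h⟩ := exists_rank_of_sat_univ hu
    exact (coherent_at α).not_proves_negD ((h x).1.1 h₁) ((h (negD x)).1.1 h₂)
  | u_self =>
    intro hu
    obtain ⟨α, -, h⟩ := exists_rank_of_sat_univ hu
    have h₁ : Proves Derivable (app (ρ 0) (ρ 1)) ↔ Proves Derivable (app (ρ 0) (trD (ρ 1))) := by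
      rw [(h _).1, (h _).1, Proves.trD_iff]
    have h₂ : Proves Derivable (app (ρ 0) (negD (ρ 1))) ↔
        Proves Derivable (app (ρ 0) (negD (trD (ρ 1)))) := by
      rw [(h _).1, (h _).1, Proves.negD_trD_iff]
    exact ⟨⟨h₁.1, h₁.2⟩, h₂.1, h₂.2⟩
  | u_class =>
    intro hu
    obtain ⟨α, -, h⟩ := exists_rank_of_sat_univ hu
    refine (modelVFU.sat_isClass _ ρ).2 fun x => ?_
    -- The universe decides every term, even one coding no sentence: whatever is not provable at `α`
    -- is rejected.
    by_cases hx : Proves (At α) x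
    · exact .inl ((h x).1.2 hx)
    · exact .inr ((h x).2.2 hx)
  | u_true =>
    intro hu x hx
    obtain ⟨α, -, h⟩ := exists_rank_of_sat_univ hu
    exact proves_derivable_iff.2 ⟨α, (h x).1.1 hx⟩
  | lim =>
    intro hf
    have hf : IsClassIn Derivable (ρ 0) := (modelVFU.sat_isClass _ ρ).1 hf
    obtain ⟨α, hα, h⟩ := exists_rank_of_isClassIn hf
    refine ⟨⟨ρ 0, rfl, hf⟩, fun x hx => ?_, fun x hx => ?_⟩
    -- The given derivation may have a rank above `α`. But `α` already decides `f x`, and a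
    -- refutation there would contradict the given derivation.
    · refine (h (app (ρ 0) x)).1.2 ((hα x).resolve_right fun hn => ?_)
      exact coherent_derivable.not_proves_negD hx (proves_derivable_iff.2 ⟨α, hn⟩)
    · refine (h (negD (app (ρ 0) x))).1.2 ((hα x).resolve_left fun hn => ?_)
      exact coherent_derivable.not_proves_negD (proves_derivable_iff.2 ⟨α, hn⟩) hx

end FregeVFU

theorem mainTheorem9 : FregeVFU.modelVFU.Models FregeVFU.VFU := by
  rintro _ ⟨n, B, hB, rfl⟩
  exact (FregeVFU.modelVFU.sat_close B).2 fun ρ => FregeVFU.modelVFU_sat hB ρ
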